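/- Let $k$ be an algebraically closed field of characteristic $0$, let $X$ be an irreducible smooth algebraic variety over $k$ endowed with an algebraic action of a finite group $G$, and assume that there exists a geometric quotient $\pi_X: X\to X/G$. Call two (closed) points $x,x'$ of $X$ of the same type if there is $g\in G$ such that $G_{g\cdot x}=G_{x'}=:H$ and the $H$-modules $T_{g\cdot x,X}$ and $T_{x',X}$ are isomorphic (equivalently, the vector $G$-bundles $G*_{G_x}T_{x,X}\to G/G_x$ and $G*_{G_{x'}}T_{x',X}\to G/G_{x'}$ are isomorphic). The strata of $X$ are the equivalence classes of this relation, the strata of $X/G$ are their images, and the principal stratum $(X/G)_0$ is the union of all strata of $X/G$ of codimension $0$. For an irreducible variety $Y$ with smooth locus $Y_{\mathrm{sm}}$, a rational tensor field of type $\binom pq$ on $Y$ is a rational section of $T(Y_{\mathrm{sm}})^{\otimes p}\otimes T^*(Y_{\mathrm{sm}})^{\otimes q}$; it is regular on a subset $U$ of $Y$ if $U$ is contained in the set of points of $Y_{\mathrm{sm}}$ where it is defined. The pull back $\pi_X^*(\tau)$ of a rational tensor field $\tau$ on $X/G$ is the rational tensor field on $X$ given at general points $x$ by $\pi_X^*(\tau)(x)=\bigl(((d_x\pi_X)^{-1})^{\otimes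 p}\otimes((d_x\pi_X)^*)^{\otimes q}\bigr)(\tau(\pi_X(x)))$. Assume that $X$ contains no strata of codimension $1$. Then for all $p,q\geq 0$ and every rational tensor field $\tau$ of type $\binom pq$ on $X/G$, the pull back $\pi_X^*(\tau)$ is regular on $X$ if and only if $\tau$ is regular on the principal stratum $(X/G)_0$. -/

import Mathlib

open CategoryTheory AlgebraicGeometry TensorProduct

universe u v

namespace TensorFields

section Algebra

/-- Tensors of type `(p, q)` on a field extension `K` of `k`: the tensor product over `K` of `p`
copies of the space of `k`-derivations of `K` and `q` copies of the space of Kähler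
differentials of `K` over `k`. -/
abbrev FieldTensor (k K : Type*) [Field k] [Field K] [Algebra k K] (p q : ℕ) :=
  (⨂[K] _ : Fin p, Derivation k K K) ⊗[K] (⨂[K] _ : Fin q, Ω[K⁄k])

/-- For a subring `A` of `K`, the `A`-submodule of the tensors of type `(p, q)` which is generated
by the products of `p` derivations of `K` preserving `A` and of `q` differentials in the
`A`-span of all `da`, `a ∈ A`. -/
noncomputable def regularTensors (k : Type*) {K : Type*} [Field k] [Field K] [Algebra k K]
    (A : Subring K) (p q : ℕ) : Submodule A (FieldTensor k K p q) :=
  Submodule.span A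
    {t | ∃ (D : Fin p → Derivation k K K) (ω : Fin q → Ω[K⁄k]),
      (∀ i, ∀ a ∈ A, D i a ∈ A) ∧
      (∀ j, ω j ∈ Submodule.span A {η : Ω[K⁄k] | ∃ a ∈ A, η = KaehlerDifferential.D k K a}) ∧
      t = (PiTensorProduct.tprod K D) ⊗ₜ[K] (PiTensorProduct.tprod K ω)}

variable (k L K : Type*) [Field k] [Field L] [Field K] [Algebra k L] [Algebra k K] [Algebra L K]
  [IsScalarTower k L K] [Algebra.FormallyEtale L K]

/-- The unique extension of a `k`-derivation of `L` to a `k`-derivation of `K`, when `K / L` is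
formally étale. -/
noncomputable def liftDerivation : Derivation k L L →ₗ[L] Derivation k K K where
  toFun D := ((KaehlerDifferential.isBaseChange_of_formallyEtale k L K).lift
    ((Algebra.linearMap L K) ∘ₗ D.liftKaehlerDifferential)).compDer (KaehlerDifferential.D k K)
  map_add' D₁ D₂ := by
    have H := KaehlerDifferential.isBaseChange_of_formallyEtale k L K
    have : H.lift ((Algebra.linearMap L K) ∘ₗ (D₁ + D₂).liftKaehlerDifferential) =
        H.lift ((Algebra.linearMap L K) ∘ₗ D₁.liftKaehlerDifferential) +
        H.lift ((Algebra.linearMap L K) ∘ₗ D₂.liftKaehlerDifferential) := by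
      refine H.algHom_ext _ _ fun x => ?_
      have h2 : (D₁ + D₂).liftKaehlerDifferential =
          D₁.liftKaehlerDifferential + D₂.liftKaehlerDifferential :=
        Derivation.liftKaehlerDifferential_unique _ _ (by ext; simp)
      simp only [LinearMap.add_apply, H.lift_eq, h2, LinearMap.comp_apply, map_add]
    ext a
    simp [this]
  map_smul' c D := by
    have H := KaehlerDifferential.isBaseChange_of_formallyEtale k L K
    have : H.lift ((Algebra.linearMap L K) ∘ₗ (c • D).liftKaehlerDifferential) =
        (algebraMap L K c) • H.lift ((Algebra.linearMap L K) ∘ₗ D.liftKaehlerDifferential) := by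
      refine H.algHom_ext _ _ fun x => ?_
      have h2 : (c • D).liftKaehlerDifferential = c • D.liftKaehlerDifferential :=
        Derivation.liftKaehlerDifferential_unique _ _ (by ext; simp)
      simp only [LinearMap.smul_apply, H.lift_eq, h2, LinearMap.comp_apply, map_smul,
        algebraMap_smul]
    ext a
    simp [this, Algebra.smul_def]

/-- The defining property of the extension of a derivation. -/
theorem liftDerivation_algebraMap (D : Derivation k L L) (a : L) :
    liftDerivation k L K D (algebraMap L K a) = algebraMap L K (D a) := by
  have H := KaehlerDifferential.isBaseChange_of_formallyEtale k L K
  have h := H.lift_eq ((Algebra.linearMap L K) ∘ₗ D.liftKaehlerDifferential)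
    (KaehlerDifferential.D k L a)
  rw [KaehlerDifferential.map_D] at h
  simpa [liftDerivation] using h

/-- The map induced on tensors of type `(p, q)` by a formally étale field extension `K / L`. On
vector fields it is the extension of derivations (the inverse of the differential), on
differentials it is `a db ↦ a db`. -/
noncomputable def pullbackTensor (p q : ℕ) :
    FieldTensor k L p q →ₗ[L] FieldTensor k K p q :=
  TensorProduct.lift <|
    ((TensorProduct.mk K (⨂[K] _ : Fin p, Derivation k K K)
        (⨂[K] _ : Fin q, Ω[K⁄k])).restrictScalars₁₂ L L).compl₁₂
      (PiTensorProduct.lift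
        (((PiTensorProduct.tprod K).restrictScalars L).compLinearMap
          fun _ : Fin p => liftDerivation k L K))
      (PiTensorProduct.lift
        (((PiTensorProduct.tprod K).restrictScalars L).compLinearMap
          fun _ : Fin q => KaehlerDifferential.map k k L K))

theorem pullbackTensor_tmul (p q : ℕ) (D : Fin p → Derivation k L L) (ω : Fin q → Ω[L⁄k]) :
    pullbackTensor k L K p q
        ((PiTensorProduct.tprod L D) ⊗ₜ[L] (PiTensorProduct.tprod L ω)) =
      (PiTensorProduct.tprod K fun i => liftDerivation k L K (D i)) ⊗ₜ[K]
        (PiTensorProduct.tprod K fun j => KaehlerDifferential.map k k L K (ω j)) := by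
  simp [pullbackTensor]

end Algebra

section Varieties

variable {k : Type u} [Field k]

/-- Irreducible algebraic varieties over `k` (for `k` algebraically closed): integral separated
schemes of finite type over `k`. -/
class IsVariety (X : Over (Spec (CommRingCat.of k))) : Prop extends
  IsIntegral X.left, IsSeparated X.hom, LocallyOfFiniteType X.hom, QuasiCompact X.hom

/-- The local rings of a `k`-scheme are `k`-algebras. In particular so is the function field. -/
noncomputable instance stalkAlgebra (X : Over (Spec (CommRingCat.of k))) (x : X.left) :
    Algebra k (X.left.presheaf.stalk x) :=
  RingHom.toAlgebra <| CommRingCat.Hom.hom <|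
    (Scheme.ΓSpecIso (CommRingCat.of k)).inv ≫ X.hom.appTop ≫ X.left.presheaf.germ ⊤ x (TopologicalSpace.Opens.mem_top x)

/-- The homomorphism of local rings `𝒪_y → 𝒪_x` induced by a morphism with `φ x = y`. -/
noncomputable def stalkHom {X Y : Over (Spec (CommRingCat.of k))} (φ : X ⟶ Y)
    (x : X.left) (y : Y.left) (h : φ.left x = y) :
    Y.left.presheaf.stalk y →ₐ[k] X.left.presheaf.stalk x where
  toRingHom := CommRingCat.Hom.hom <|
    Y.left.presheaf.stalkSpecializes (specializes_of_eq h) ≫ φ.left.stalkMap x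
  commutes' a := by
    have h1 : Y.left.presheaf.germ ⊤ y (TopologicalSpace.Opens.mem_top y) ≫
        Y.left.presheaf.stalkSpecializes (specializes_of_eq h) ≫ φ.left.stalkMap x =
        φ.left.appTop ≫ X.left.presheaf.germ ⊤ x (TopologicalSpace.Opens.mem_top x) := by
      rw [TopCat.Presheaf.germ_stalkSpecializes_assoc]
      exact Scheme.Hom.germ_stalkMap φ.left ⊤ x (TopologicalSpace.Opens.mem_top _)
    have h2 : Y.hom.appTop ≫ φ.left.appTop = X.hom.appTop := by
      rw [← Over.w φ]; rfl
    have h3 : ((Scheme.ΓSpecIso (CommRingCat.of k)).inv ≫ Y.hom.appTop ≫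
        Y.left.presheaf.germ ⊤ y (TopologicalSpace.Opens.mem_top y)) ≫
        (Y.left.presheaf.stalkSpecializes (specializes_of_eq h) ≫ φ.left.stalkMap x) =
        (Scheme.ΓSpecIso (CommRingCat.of k)).inv ≫ X.hom.appTop ≫
          X.left.presheaf.germ ⊤ x (TopologicalSpace.Opens.mem_top x) := by
      simp only [Category.assoc]
      rw [h1, ← h2]
      simp only [Category.assoc]
    exact DFunLike.congr_fun (CommRingCat.hom_ext_iff.mp h3) a

theorem isLocalHom_stalkHom {X Y : Over (Spec (CommRingCat.of k))} (φ : X ⟶ Y)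
    (x : X.left) (y : Y.left) (h : φ.left x = y) : IsLocalHom (stalkHom φ x y h).toRingHom := by
  subst h
  have : (stalkHom φ x _ rfl).toRingHom = (φ.left.stalkMap x).hom := by
    change (Y.left.presheaf.stalkSpecializes (specializes_of_eq rfl) ≫ φ.left.stalkMap x).hom = _
    simp
  rw [this]
  infer_instance

/-- The Zariski tangent space at a `k`-rational point `x`: the dual of `𝔪 / 𝔪 ^ 2`. -/
abbrev TangentSpaceAt (X : Over (Spec (CommRingCat.of k))) (x : X.left) :=
  Module.Dual k (IsLocalRing.maximalIdeal (X.left.presheaf.stalk x)).Cotangent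

/-- The differential `d_x φ : T_x X → T_y Y` of a morphism with `φ x = y`. -/
noncomputable def differential {X Y : Over (Spec (CommRingCat.of k))} (φ : X ⟶ Y)
    (x : X.left) (y : Y.left) (h : φ.left x = y) :
    TangentSpaceAt X x →ₗ[k] TangentSpaceAt Y y :=
  LinearMap.dualMap (Ideal.mapCotangent _ _ (stalkHom φ x y h) (by
    have := isLocalHom_stalkHom φ x y h
    exact ((IsLocalRing.local_hom_TFAE (stalkHom φ x y h).toRingHom).out 0 3).mp this))

/-- The smooth locus: the points with an open neighbourhood that is smooth over `k`. -/
def smoothLocus (Y : Over (Spec (CommRingCat.of k))) : Set Y.left :=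
  {y | ∃ U : Y.left.Opens, y ∈ U ∧ Smooth (U.ι ≫ Y.hom)}

section RationalTensorFields

variable (Y : Over (Spec (CommRingCat.of k))) [IsIntegral Y.left]

/-- Rational tensor fields of type `(p, q)` on an irreducible variety `Y`, that is, rational
sections of `T(Y_sm)^{⊗ p} ⊗ T^*(Y_sm)^{⊗ q}`: the elements of the fibre of this
bundle at the generic point. -/
abbrev RationalTensorField (p q : ℕ) := FieldTensor k Y.left.functionField p q

/-- The local ring at `y` as a subring of the function field. -/
noncomputable def localRing (y : Y.left) : Subring Y.left.functionField :=
  (algebraMap (Y.left.presheaf.stalk y) Y.left.functionField).range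

variable {Y}

/-- The domain of definition of a rational tensor field: the set of all points `y` of the smooth
locus such that the field lies in the stalk of `T(Y_sm)^{⊗ p} ⊗ T^*(Y_sm)^{⊗ q}` at `y`. -/
def domain {p q : ℕ} (τ : RationalTensorField Y p q) : Set Y.left :=
  {y | y ∈ smoothLocus Y ∧ τ ∈ regularTensors k (localRing Y y) p q}

/-- A rational tensor field is regular on a set of points if it is defined at all of them. -/
def RegularOn {p q : ℕ} (τ : RationalTensorField Y p q) (U : Set Y.left) : Prop :=
  U ⊆ domain τ

end RationalTensorFields

section Pullback

variable {X Y : Over (Spec (CommRingCat.of k))} [IsIntegral X.left] [IsIntegral Y.left]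

theorem map_genericPoint {φ : X ⟶ Y} (h : DenseRange φ.left) :
    φ.left (genericPoint X.left) = genericPoint Y.left := by
  refine ((genericPoint_spec Y.left).eq ?_).symm
  have := (genericPoint_spec X.left).image φ.left.continuous
  rwa [Set.image_univ, h.closure_range] at this

/-- The homomorphism of function fields `φ^* : k(Y) → k(X)` of a dominant morphism. -/
noncomputable def functionFieldHom (φ : X ⟶ Y) (h : DenseRange φ.left) :
    Y.left.functionField →ₐ[k] X.left.functionField :=
  stalkHom φ (genericPoint X.left) (genericPoint Y.left) (map_genericPoint h)

/-- Dominant morphisms between irreducible varieties of the same dimension: dominant morphisms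
for which the extension of function fields is algebraic. -/
structure IsGenericallyFinite (φ : X ⟶ Y) : Prop where
  dominant : DenseRange φ.left
  algebraic : (functionFieldHom φ dominant).toRingHom.IsIntegral

/-- The pull back of a rational tensor field along a generically finite morphism in
characteristic `0`. -/
noncomputable def pullback [CharZero k] {φ : X ⟶ Y} (h : IsGenericallyFinite φ) {p q : ℕ}
    (τ : RationalTensorField Y p q) : RationalTensorField X p q :=
  letI : Algebra Y.left.functionField X.left.functionField :=
    (functionFieldHom φ h.dominant).toRingHom.toAlgebra
  haveI : IsScalarTower k Y.left.functionField X.left.functionField :=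
    IsScalarTower.of_algebraMap_eq fun a => ((functionFieldHom φ h.dominant).commutes a).symm
  haveI : CharZero Y.left.functionField :=
    charZero_of_injective_algebraMap (algebraMap k Y.left.functionField).injective
  haveI : Algebra.IsIntegral Y.left.functionField X.left.functionField := ⟨h.algebraic⟩
  haveI : Algebra.FormallyEtale Y.left.functionField X.left.functionField :=
    Algebra.FormallyEtale.of_isSeparable _ _
  pullbackTensor k Y.left.functionField X.left.functionField p q τ

end Pullback

section Quotient

variable {G : Type v} [Group G] {X Y : Over (Spec (CommRingCat.of k))}

/-- The automorphism `x ↦ g · x` of `X` given by an action `ρ` of `G` on `X`. -/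
noncomputable def act (ρ : G →* Aut X) (g : G) : X ⟶ X := (ρ g).hom

theorem act_one (ρ : G →* Aut X) : act ρ 1 = 𝟙 X := by
  unfold act; rw [map_one]; rfl

theorem act_mul (ρ : G →* Aut X) (a b : G) : act ρ (a * b) = act ρ b ≫ act ρ a := by
  unfold act; rw [map_mul]; rfl

theorem preimage_le_preimage {ψ : X ⟶ X} {π : X ⟶ Y} (h : ψ ≫ π = π) (V : Y.left.Opens) :
    π.left ⁻¹ᵁ V ≤ ψ.left ⁻¹ᵁ (π.left ⁻¹ᵁ V) := by
  have : ψ.left ≫ π.left = π.left := by rw [← Over.comp_left, h]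
  rw [← Scheme.Hom.comp_preimage, this]

/-- `π : X ⟶ Y` is a geometric quotient of `X` by the action `ρ` of `G`: it is constant on orbits,
its fibres are the orbits, `Y` carries the quotient topology (so `π` is surjective), and for every
open `V ⊆ Y` pulling back functions identifies `𝒪(V)` with the `G`-invariants
of `𝒪(π⁻¹ V)`. -/
structure IsGeometricQuotient (ρ : G →* Aut X) (π : X ⟶ Y) : Prop where
  invariant : ∀ g, act ρ g ≫ π = π
  orbit : ∀ x x' : X.left, π.left x = π.left x' → ∃ g, (act ρ g).left x = x'
  isQuotientMap : Topology.IsQuotientMap π.left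
  injective : ∀ V : Y.left.Opens, Function.Injective (π.left.app V)
  surjective : ∀ (V : Y.left.Opens) (s : Γ(X.left, π.left ⁻¹ᵁ V)),
    (∀ g, (act ρ g).left.appLE _ _ (preimage_le_preimage (invariant g) V) s = s) →
      ∃ t, π.left.app V t = s

theorem functionFieldHom_germ [IsIntegral X.left] [IsIntegral Y.left] (φ : X ⟶ Y)
    (h : DenseRange φ.left) (V : Y.left.Opens) (hY : genericPoint Y.left ∈ V)
    (hX : genericPoint X.left ∈ φ.left ⁻¹ᵁ V) (t : Γ(Y.left, V)) :
    functionFieldHom φ h (Y.left.presheaf.germ V _ hY t) =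
      X.left.presheaf.germ (φ.left ⁻¹ᵁ V) _ hX (φ.left.app V t) := by
  have h1 : Y.left.presheaf.germ V _ hY ≫
      (Y.left.presheaf.stalkSpecializes (specializes_of_eq (map_genericPoint h)) ≫
        φ.left.stalkMap (genericPoint X.left)) =
      φ.left.app V ≫ X.left.presheaf.germ (φ.left ⁻¹ᵁ V) _ hX := by
    rw [TopCat.Presheaf.germ_stalkSpecializes_assoc]
    exact Scheme.Hom.germ_stalkMap φ.left V _ hX
  exact DFunLike.congr_fun (CommRingCat.hom_ext_iff.mp h1) t

/-- Functions on `π⁻¹ V` are integral over functions on `V`. -/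
theorem IsGeometricQuotient.isIntegral_app [Finite G]
    {ρ : G →* Aut X} {π : X ⟶ Y} (h : IsGeometricQuotient ρ π) (V : Y.left.Opens) :
    (π.left.app V).hom.IsIntegral := by
  let σ (g : G) : Γ(X.left, π.left ⁻¹ᵁ V) ⟶ Γ(X.left, π.left ⁻¹ᵁ V) :=
    (act ρ g).left.appLE _ _ (preimage_le_preimage (h.invariant g) V)
  have σ_one : σ 1 = 𝟙 _ := by
    have h1 : (act ρ 1).left = 𝟙 X.left := by rw [act_one]; rfl
    have h2 : ∀ (f : X.left ⟶ X.left) (U : X.left.Opens) (e : U ≤ f ⁻¹ᵁ U), f = 𝟙 _ →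
        f.appLE U U e = 𝟙 _ := by
      rintro f U e rfl
      simp only [Scheme.Hom.appLE, Scheme.Hom.id_app]
      exact X.left.presheaf.map_id _
    exact h2 _ _ _ h1
  have σ_mul (a b : G) : σ (a * b) = σ a ≫ σ b := by
    have h1 : (act ρ (a * b)).left = (act ρ b).left ≫ (act ρ a).left := by rw [act_mul]; rfl
    simp only [σ]
    rw [Scheme.Hom.appLE_comp_appLE]
    congr 1
  let : MulSemiringAction G Γ(X.left, π.left ⁻¹ᵁ V) :=
    { smul := fun g s => (σ g⁻¹).hom s
      one_smul := fun s => by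
        change (σ 1⁻¹).hom s = s
        rw [inv_one, σ_one]; rfl
      mul_smul := fun a b s => by
        change (σ (a * b)⁻¹).hom s = (σ a⁻¹).hom ((σ b⁻¹).hom s)
        rw [mul_inv_rev, σ_mul]; rfl
      smul_zero := fun g => map_zero (σ g⁻¹).hom
      smul_add := fun g => map_add (σ g⁻¹).hom
      smul_one := fun g => map_one (σ g⁻¹).hom
      smul_mul := fun g => map_mul (σ g⁻¹).hom }
  let := (π.left.app V).hom.toAlgebra
  have : Algebra.IsInvariant Γ(Y.left, V) Γ(X.left, π.left ⁻¹ᵁ V) G :=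
    ⟨fun s hs => h.surjective V s fun g => by
      have := hs g⁻¹
      change (σ g⁻¹⁻¹).hom s = s at this
      rwa [inv_inv] at this⟩
  exact (Algebra.IsInvariant.isIntegral Γ(Y.left, V) Γ(X.left, π.left ⁻¹ᵁ V) G).isIntegral

/-- A geometric quotient by a finite group is generically finite. -/
theorem IsGeometricQuotient.isGenericallyFinite [Finite G] [IsIntegral X.left] [IsIntegral Y.left]
    {ρ : G →* Aut X} {π : X ⟶ Y} (h : IsGeometricQuotient ρ π) : IsGenericallyFinite π := by
  refine ⟨h.isQuotientMap.surjective.denseRange, fun f => ?_⟩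
  obtain ⟨W, hW, s, rfl⟩ := X.left.presheaf.exists_germ_eq f
  have hgen (g : G) : (act ρ g).left (genericPoint X.left) = genericPoint X.left := by
    refine map_genericPoint (Function.Surjective.denseRange fun x => ⟨(act ρ g⁻¹).left x, ?_⟩)
    rw [← Scheme.Hom.comp_apply, ← Over.comp_left, ← act_mul, mul_inv_cancel, act_one]
    rfl
  let W' : Set X.left := ⋂ g, (act ρ g).left ⁻¹' W
  have hW' : IsOpen W' := isOpen_iInter_of_finite fun g =>
    W.isOpen.preimage (act ρ g).left.continuous
  have hsat : π.left ⁻¹' (π.left '' W') = W' := by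
    refine Set.Subset.antisymm ?_ (Set.subset_preimage_image _ _)
    rintro x ⟨y, hy, hxy⟩
    obtain ⟨a, rfl⟩ := h.orbit y x hxy
    refine Set.mem_iInter.mpr fun g => ?_
    have := Set.mem_iInter.mp hy (g * a)
    have h1 : (act ρ (g * a)).left = (act ρ a).left ≫ (act ρ g).left := by rw [act_mul]; rfl
    rw [h1] at this
    simpa using this
  let V : Y.left.Opens := ⟨π.left '' W', h.isQuotientMap.isOpen_preimage.mp (by rw [hsat]; exact hW')⟩
  have hVW : π.left ⁻¹ᵁ V ≤ W := by
    intro x hx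
    have hx' : x ∈ W' := hsat ▸ hx
    have h1 : (act ρ 1).left = 𝟙 X.left := by rw [act_one]; rfl
    have := Set.mem_iInter.mp hx' 1
    rw [h1] at this
    simpa using this
  have hgW : genericPoint X.left ∈ W' := Set.mem_iInter.mpr fun g => by
    change (act ρ g).left (genericPoint X.left) ∈ W
    rw [hgen g]; exact hW
  have hX : genericPoint X.left ∈ π.left ⁻¹ᵁ V := ⟨_, hgW, rfl⟩
  have hd := h.isQuotientMap.surjective.denseRange
  have hY : genericPoint Y.left ∈ V := by rw [← map_genericPoint hd]; exact hX
  obtain ⟨P, hP, hP0⟩ := h.isIntegral_app V (X.left.presheaf.map (homOfLE hVW).op s)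
  refine ⟨P.map (Y.left.presheaf.germ V _ hY).hom, hP.map _, ?_⟩
  have hcomp : (functionFieldHom π hd).toRingHom.comp (Y.left.presheaf.germ V _ hY).hom =
      (X.left.presheaf.germ (π.left ⁻¹ᵁ V) _ hX).hom.comp (π.left.app V).hom :=
    RingHom.ext fun t => functionFieldHom_germ π hd V hY hX t
  have hs : X.left.presheaf.germ W _ hW s = (X.left.presheaf.germ (π.left ⁻¹ᵁ V) _ hX).hom
      (X.left.presheaf.map (homOfLE hVW).op s) :=
    (TopCat.Presheaf.germ_res_apply _ _ _ _ _).symm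
  rw [Polynomial.eval₂_map, hcomp, hs, ← Polynomial.hom_eval₂, hP0, map_zero]

/-- The action `ρ` has the same type at `x` and `x'`: for some `z` in the orbit of `x`, the
stabilizers of `z` and `x'` are the same subgroup `H` of `G`, and the tangent spaces at `z` and
`x'` are isomorphic as `H`-modules. Equivalently, the normal bundles
`G *_{G_x} T_x X → G / G_x` and `G *_{G_{x'}} T_{x'} X → G / G_{x'}` of the orbits are isomorphic
vector `G`-bundles. -/
def SameType (ρ : G →* Aut X) (x x' : X.left) : Prop :=
  ∃ (g : G) (z : X.left), (act ρ g).left x = z ∧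
    (∀ h, (act ρ h).left z = z ↔ (act ρ h).left x' = x') ∧
    ∃ e : TangentSpaceAt X z ≃ₗ[k] TangentSpaceAt X x',
      ∀ (h : G) (hz : (act ρ h).left z = z) (hx : (act ρ h).left x' = x') (v : TangentSpaceAt X z),
        e (differential (act ρ h) z z hz v) = differential (act ρ h) x' x' hx (e v)

/-- The strata of `X`: the nonempty sets of closed points where the action has a given type. -/
def IsStratum (ρ : G →* Aut X) (S : Set X.left) : Prop :=
  ∃ x ∈ closedPoints X.left, S = {x' | x' ∈ closedPoints X.left ∧ SameType ρ x' x}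

/-- The strata of the quotient `Y = X / G`: the images of the strata of `X`. -/
def IsQuotientStratum (ρ : G →* Aut X) (π : X ⟶ Y) (T : Set Y.left) : Prop :=
  ∃ S, IsStratum ρ S ∧ T = π.left '' S

/-- The codimension of (the closure of) a subset of a scheme: the least codimension of an
irreducible closed subset contained in the closure. -/
noncomputable def codim {Z : Scheme.{u}} (S : Set Z) : ℕ∞ :=
  ⨅ z ∈ closure S, Order.coheight z

/-- The principal stratum `(X / G)_0`: the union of all strata of codimension `0`. -/
def principalStratum (ρ : G →* Aut X) (π : X ⟶ Y) : Set Y.left :=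
  ⋃₀ {T | IsQuotientStratum ρ π T ∧ codim T = 0}

end Quotient

end Varieties

end TensorFields

/-! Along a dense stratum the quotient map is étale. Up to translation by the finite group, such a
stratum consists of points with one fixed stabilizer; since these points are dense, that stabilizer
acts trivially on `X` (`IsStratum.isFreeAt`). Put `B` for the local ring of `X/G` at `π x`, `A` for
that of `X` at `x`, `K` for the function field of `X`, and `Γ` for the image of `G` in the
automorphisms of `K`. Zariski's main theorem makes `A` a localization of the integral closure of `B`
in `K`, and separatedness shows that only the identity of `Γ` preserves `A`. Hence `Γ` acts freely
on the maximal ideals of that closure, and a free action of a finite group is étale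
(`formallyEtale_of_smul_range_le`).

An étale local extension allows coordinates of `A` to be chosen in `B`. In such common coordinates a
tensor field and its pull back have the same coefficients, and a rational function on `X/G` lies in
`A` exactly when it lies in `B`. So `X/G` is smooth at `π x`, and `τ` is regular at `π x` if and
only if its pull back is regular at `x`
(`IsGeometricQuotient.mem_smoothLocus_and_regularTensors_iff`). This already gives one direction.

For the converse, coefficients in local coordinates are functions on a normal variety, so regularity
of the pull back need only be checked at points `x'` of codimension at most one
(`mem_regularTensors_of_coheight_le_one`). An affine open set meets finitely many strata, because a
finite group has finitely many representations of bounded dimension (`exists_finite_strata`). Closed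
points being dense in every closed subset, `x'` lies in the closure of some stratum's part inside
the closure of `x'`. That stratum has codimension at most one, hence zero, so `x'` specializes to a
point of a dense stratum (`exists_specializes_mem_stratum`). There the pull back is regular, and
regularity passes to generizations. -/

namespace TensorFields

/-! ### Free actions of finite groups on rings are étale. -/

section GaloisRings

variable {B C Γ : Type*} [CommRing B] [CommRing C] [Algebra B C] [Group Γ]
  [MulSemiringAction Γ C] [SMulCommClass Γ B C]

/-- The map `x ⊗ y ↦ x * σ y`. -/
noncomputable def twistedMul (B : Type*) {C Γ : Type*} [CommRing B] [CommRing C] [Algebra B C]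
    [Group Γ] [MulSemiringAction Γ C] [SMulCommClass Γ B C] (σ : Γ) : C ⊗[B] C →ₐ[B] C :=
  Algebra.TensorProduct.lift (AlgHom.id B C) (MulSemiringAction.toAlgHom B C σ)
    fun _ _ => Commute.all _ _

@[simp]
theorem twistedMul_tmul (σ : Γ) (x y : C) : twistedMul B σ (x ⊗ₜ[B] y) = x * σ • y := by
  simp [twistedMul]

/-- If `Γ` acts freely on the maximal spectrum, there is an element of `C ⊗ C` that is `1` on the
graph of the identity and `0` on the graphs of all other elements of `Γ`. -/
theorem exists_twistedMul_eq_ite [Finite Γ]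
    (h : ∀ σ : Γ, σ ≠ 1 → Ideal.span (Set.range fun c : C => c - σ • c) = ⊤) :
    ∃ e : C ⊗[B] C, twistedMul B (1 : Γ) e = 1 ∧ ∀ σ : Γ, σ ≠ 1 → twistedMul B σ e = 0 := by
  classical
  cases nonempty_fintype Γ
  have H (σ : Γ) (hσ : σ ≠ 1) :
      ∃ e : C ⊗[B] C, twistedMul B (1 : Γ) e = 1 ∧ twistedMul B σ e = 0 := by
    have h1 : (1 : C) ∈ Ideal.span (Set.range fun c : C => c - σ • c) := by
      rw [h σ hσ]; trivial
    -- The values on the identity graph of elements vanishing on the graph of `σ` form an ideal. It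
    -- contains each `c - σ • c`, through `1 ⊗ c - (σ • c) ⊗ 1`.
    have key : ∀ a ∈ Ideal.span (Set.range fun c : C => c - σ • c),
        ∃ e : C ⊗[B] C, twistedMul B (1 : Γ) e = a ∧ twistedMul B σ e = 0 := by
      intro a ha
      induction ha using Submodule.span_induction with
      | mem x hx =>
        obtain ⟨c, rfl⟩ := hx
        exact ⟨1 ⊗ₜ c - (σ • c) ⊗ₜ 1, by simp, by simp⟩
      | zero => exact ⟨0, by simp, by simp⟩
      | add x y _ _ hx hy =>
        obtain ⟨e, he, he'⟩ := hx
        obtain ⟨f, hf, hf'⟩ := hy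
        exact ⟨e + f, by simp [he, hf], by simp [he', hf']⟩
      | smul r x _ hx =>
        obtain ⟨e, he, he'⟩ := hx
        exact ⟨(r ⊗ₜ 1) * e, by simp [he], by simp [he']⟩
    exact key 1 h1
  choose e he he' using H
  refine ⟨∏ σ : {σ : Γ // σ ≠ 1}, e σ.1 σ.2, ?_, fun σ hσ => ?_⟩
  · rw [map_prod]
    exact Finset.prod_eq_one fun σ _ => he σ.1 σ.2
  · rw [map_prod]
    exact Finset.prod_eq_zero (Finset.mem_univ ⟨σ, hσ⟩) (he' σ hσ)

/-- Galois coordinates. -/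
theorem exists_galois_coordinates (B : Type*) {C Γ : Type*} [CommRing B] [CommRing C]
    [Algebra B C] [Group Γ] [Finite Γ] [MulSemiringAction Γ C] [SMulCommClass Γ B C]
    (h : ∀ σ : Γ, σ ≠ 1 → Ideal.span (Set.range fun c : C => c - σ • c) = ⊤) :
    ∃ (n : ℕ) (x y : Fin n → C), ∑ i, x i * y i = 1 ∧
      ∀ σ : Γ, σ ≠ 1 → ∑ i, x i * σ • y i = 0 := by
  obtain ⟨e, he, he'⟩ := exists_twistedMul_eq_ite (B := B) h
  obtain ⟨n, x, y, rfl⟩ := TensorProduct.exists_sum_tmul_eq e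
  refine ⟨n, x, y, ?_, fun σ hσ => ?_⟩
  · simpa using he
  · simpa using he' σ hσ

variable [Finite Γ] [Algebra.IsInvariant B C Γ] [FaithfulSMul B C]

/-- The trace of a finite group action. -/
theorem exists_trace (B C Γ : Type*) [CommRing B] [CommRing C] [Algebra B C] [Group Γ] [Fintype Γ]
    [MulSemiringAction Γ C] [SMulCommClass Γ B C] [Algebra.IsInvariant B C Γ] [FaithfulSMul B C] :
    ∃ tr : C →ₗ[B] B, ∀ c, algebraMap B C (tr c) = ∑ σ : Γ, σ • c := by
  have H (c : C) : ∃ b, algebraMap B C b = ∑ σ : Γ, σ • c :=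
    Algebra.IsInvariant.isInvariant (G := Γ) _ fun g => by
      rw [Finset.smul_sum]
      simp_rw [smul_smul]
      exact Fintype.sum_equiv (Equiv.mulLeft g) _ _ fun _ => rfl
  choose t ht using H
  have inj := FaithfulSMul.algebraMap_injective B C
  exact ⟨{ toFun := t
           map_add' := fun a b => inj (by simp [ht, smul_add, Finset.sum_add_distrib])
           map_smul' := fun r a => inj (by
            rw [ht, RingHom.id_apply, smul_eq_mul, map_mul, ht, ← Algebra.smul_def,
              Finset.smul_sum]
            exact Finset.sum_congr rfl fun σ _ => smul_comm σ r a) }, ht⟩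

/-- Galois coordinates `x`, `y` do everything. The `x i` with the functionals `c ↦ tr (y i * c)`
form a finite dual basis, whence finite and projective; `∑ x i ⊗ y i` is a separability idempotent,
whence unramified. -/
theorem projective_finite_unramified_of_free_action
    (h : ∀ σ : Γ, σ ≠ 1 → Ideal.span (Set.range fun c : C => c - σ • c) = ⊤) :
    Module.Finite B C ∧ Module.Projective B C ∧ Algebra.FormallyUnramified B C := by
  classical
  cases nonempty_fintype Γ
  obtain ⟨n, x, y, h1, h0⟩ := exists_galois_coordinates B h
  obtain ⟨tr, htr⟩ := exists_trace B C Γ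
  have hd (σ : Γ) : ∑ i, x i * σ • y i = if σ = 1 then 1 else 0 := by
    split_ifs with hσ
    · simpa [hσ] using h1
    · exact h0 σ hσ
  -- Applying `σ` to the relation for `σ⁻¹` interchanges the roles of `x` and `y`.
  have hd' (σ : Γ) : ∑ i, σ • x i * y i = if σ = 1 then 1 else 0 := by
    have := congrArg (σ • ·) (hd σ⁻¹)
    simp only [Finset.smul_sum, smul_mul', smul_smul, mul_inv_cancel, one_smul] at this
    rw [this]
    split_ifs <;> simp_all
  have hA (c : C) : ∑ i, tr (y i * c) • x i = c := by
    calc ∑ i, tr (y i * c) • x i = ∑ i, ∑ σ : Γ, x i * (σ • y i) * σ • c := by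
          refine Finset.sum_congr rfl fun i _ => ?_
          rw [Algebra.smul_def, htr, Finset.sum_mul]
          refine Finset.sum_congr rfl fun σ _ => ?_
          rw [smul_mul']; ring
      _ = ∑ σ : Γ, (∑ i, x i * (σ • y i)) * σ • c := by
          rw [Finset.sum_comm]; simp_rw [Finset.sum_mul]
      _ = c := by simp [hd]
  have hB (c : C) : ∑ i, tr (c * x i) • y i = c := by
    calc ∑ i, tr (c * x i) • y i = ∑ i, ∑ σ : Γ, ((σ • x i) * y i) * σ • c := by
          refine Finset.sum_congr rfl fun i _ => ?_
          rw [Algebra.smul_def, htr, Finset.sum_mul]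
          refine Finset.sum_congr rfl fun σ _ => ?_
          rw [smul_mul']; ring
      _ = ∑ σ : Γ, (∑ i, (σ • x i) * y i) * σ • c := by
          rw [Finset.sum_comm]; simp_rw [Finset.sum_mul]
      _ = c := by simp [hd']
  have fin : Module.Finite B C := by
    refine ⟨⟨Finset.univ.image x, ?_⟩⟩
    rw [eq_top_iff]
    intro c _
    rw [← hA c]
    refine Submodule.sum_mem _ fun i _ => Submodule.smul_mem _ _ (Submodule.subset_span ?_)
    simp
  refine ⟨fin, ?_, ?_⟩
  · let f : C →ₗ[B] (Fin n → B) := LinearMap.pi fun i => tr ∘ₗ LinearMap.mulLeft B (y i)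
    let g : (Fin n → B) →ₗ[B] C := Fintype.linearCombination B x
    exact Module.Projective.of_split f g (LinearMap.ext fun c => by
      simpa [f, g, Fintype.linearCombination_apply] using hA c)
  · rw [Algebra.FormallyUnramified.iff_exists_tensorProduct]
    refine ⟨∑ i, x i ⊗ₜ y i, fun s => ?_, by simpa using h1⟩
    -- To move `s` across the tensor sign, the left factor is expanded by `hA` and the right factor
    -- recollected by `hB`.
    rw [sub_mul, sub_eq_zero]
    simp only [Finset.mul_sum, Algebra.TensorProduct.tmul_mul_tmul, one_mul]
    symm
    calc ∑ i, (s * x i) ⊗ₜ[B] y i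
        = ∑ i, (∑ j, tr (y j * (s * x i)) • x j) ⊗ₜ[B] y i := by simp_rw [hA]
      _ = ∑ j, x j ⊗ₜ[B] ∑ i, tr ((s * y j) * x i) • y i := by
          simp_rw [TensorProduct.sum_tmul, TensorProduct.tmul_sum, TensorProduct.smul_tmul]
          rw [Finset.sum_comm]
          refine Finset.sum_congr rfl fun j _ => Finset.sum_congr rfl fun i _ => ?_
          rw [show y j * (s * x i) = s * y j * x i by ring]
      _ = ∑ i, x i ⊗ₜ[B] (s * y i) := by simp_rw [hB]

theorem etale_of_free_action
    (h : ∀ σ : Γ, σ ≠ 1 → Ideal.span (Set.range fun c : C => c - σ • c) = ⊤) :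
    Algebra.Etale B C := by
  obtain ⟨_, _, _⟩ := projective_finite_unramified_of_free_action (B := B) h
  have : Module.FinitePresentation B C := Module.finitePresentation_of_projective B C
  have : Algebra.FinitePresentation B C := inferInstance
  exact Algebra.Etale.of_formallyUnramified_of_flat

end GaloisRings

/-! ### Regular tensors in local coordinates. -/

section Coordinates

open Module

variable {k K : Type*} [Field k] [Field K] [Algebra k K] {ι : Type*} [Fintype ι]

/-- The coordinate vector fields dual to a basis of the space of differentials. -/
noncomputable def derivationBasis (β : Basis ι K Ω[K⁄k]) : Basis ι K (Derivation k K K) := by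
  classical exact β.dualBasis.map (KaehlerDifferential.linearMapEquivDerivation k K)

theorem derivationBasis_apply (β : Basis ι K Ω[K⁄k]) (i : ι) (a : K) :
    derivationBasis β i a = β.repr (KaehlerDifferential.D k K a) i := by
  classical simp [derivationBasis]

theorem derivationBasis_repr (β : Basis ι K Ω[K⁄k]) {i : ι} {b : K}
    (hb : β i = KaehlerDifferential.D k K b) (X : Derivation k K K) :
    (derivationBasis β).repr X i = X b := by
  classical
  simp [derivationBasis, Basis.dualBasis_repr, hb]

/-- The basis of the space of tensors of type `(p, q)` given by a basis of the space of
differentials. -/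
noncomputable def tensorBasis (β : Basis ι K Ω[K⁄k]) (p q : ℕ) :
    Basis ((Fin p → ι) × (Fin q → ι)) K (FieldTensor k K p q) :=
  (Basis.piTensorProduct fun _ => derivationBasis β).tensorProduct
    (Basis.piTensorProduct fun _ => β)

theorem tensorBasis_apply (β : Basis ι K Ω[K⁄k]) (p q : ℕ) (I : (Fin p → ι) × (Fin q → ι)) :
    tensorBasis β p q I = (PiTensorProduct.tprod K fun i => derivationBasis β (I.1 i)) ⊗ₜ[K]
      (PiTensorProduct.tprod K fun j => β (I.2 j)) := by
  obtain ⟨I, J⟩ := I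
  rw [tensorBasis, Basis.tensorProduct_apply, Basis.piTensorProduct_apply,
    Basis.piTensorProduct_apply]

theorem tensorBasis_repr_tmul (β : Basis ι K Ω[K⁄k]) (p q : ℕ) (X : Fin p → Derivation k K K)
    (ω : Fin q → Ω[K⁄k]) (I : (Fin p → ι) × (Fin q → ι)) :
    (tensorBasis β p q).repr ((PiTensorProduct.tprod K X) ⊗ₜ[K] (PiTensorProduct.tprod K ω)) I =
      (∏ i, (derivationBasis β).repr (X i) (I.1 i)) * ∏ j, β.repr (ω j) (I.2 j) := by
  obtain ⟨I, J⟩ := I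
  simp [tensorBasis, Basis.tensorProduct_repr_tmul_apply, mul_comm]

/-- The elements `b` of the subring `A` of `K` form a system of coordinates for `A`: their
differentials are a basis of the space of differentials of `K`, and the partial derivatives
preserve `A`. -/
structure IsCoordinateSystem (A : Subring K) (b : ι → K) (β : Basis ι K Ω[K⁄k]) : Prop where
  mem : ∀ i, b i ∈ A
  eq_D : ∀ i, β i = KaehlerDifferential.D k K (b i)
  repr_mem : ∀ i, ∀ a ∈ A, β.repr (KaehlerDifferential.D k K a) i ∈ A

variable {A : Subring K} {b : ι → K} {β : Basis ι K Ω[K⁄k]}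

/-- A tensor is regular if and only if its coefficients in a system of coordinates are. -/
theorem IsCoordinateSystem.mem_regularTensors_iff (h : IsCoordinateSystem A b β) {p q : ℕ}
    (t : FieldTensor k K p q) :
    t ∈ regularTensors k A p q ↔ ∀ I, (tensorBasis β p q).repr t I ∈ A := by
  constructor
  · intro ht
    unfold regularTensors at ht
    induction ht using Submodule.span_induction with
    | mem x hx =>
      obtain ⟨D, ω, hD, hω, rfl⟩ := hx
      intro I
      rw [tensorBasis_repr_tmul]
      refine A.mul_mem (A.prod_mem fun i _ => ?_) (A.prod_mem fun j _ => ?_)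
      · rw [derivationBasis_repr β (h.eq_D _)]
        exact hD _ _ (h.mem _)
      · have := hω j
        generalize ω j = η at this
        induction this using Submodule.span_induction with
        | mem x hx =>
          obtain ⟨a, ha, rfl⟩ := hx
          exact h.repr_mem _ a ha
        | zero => simp
        | add x y _ _ hx hy => simpa using A.add_mem hx hy
        | smul r x _ hx =>
          have : r • x = (r : K) • x := rfl
          rw [this, map_smul, Finsupp.smul_apply, smul_eq_mul]
          exact A.mul_mem r.2 hx
    | zero => simp
    | add x y _ _ hx hy =>
      intro I
      simpa using A.add_mem (hx I) (hy I)
    | smul r x _ hx =>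
      intro I
      have : r • x = (r : K) • x := rfl
      rw [this, map_smul, Finsupp.smul_apply, smul_eq_mul]
      exact A.mul_mem r.2 (hx I)
  · intro ht
    rw [← (tensorBasis β p q).sum_repr t]
    refine Submodule.sum_mem _ fun I _ => ?_
    have : (tensorBasis β p q).repr t I • tensorBasis β p q I =
        (⟨_, ht I⟩ : A) • tensorBasis β p q I := rfl
    rw [this]
    refine Submodule.smul_mem _ _ (Submodule.subset_span ?_)
    refine ⟨fun i => derivationBasis β (I.1 i), fun j => β (I.2 j), fun i a ha => ?_,
      fun j => ?_, tensorBasis_apply β p q I⟩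
    · rw [derivationBasis_apply]
      exact h.repr_mem _ a ha
    · exact Submodule.subset_span ⟨_, h.mem _, h.eq_D _⟩

/-- Regularity of a tensor may be checked on a family of localizations whose intersection is the
given ring, if there are common coordinates. -/
theorem IsCoordinateSystem.mem_regularTensors_of_forall (h : IsCoordinateSystem A b β) {p q : ℕ}
    (t : FieldTensor k K p q) {J : Type*} (A' : J → Subring K)
    (h' : ∀ j, IsCoordinateSystem (A' j) b β) (ht : ∀ j, t ∈ regularTensors k (A' j) p q)
    (hA : ∀ a, (∀ j, a ∈ A' j) → a ∈ A) : t ∈ regularTensors k A p q :=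
  h.mem_regularTensors_iff t |>.mpr fun I => hA _ fun j =>
    ((h' j).mem_regularTensors_iff t).mp (ht j) I

/-- Coordinates for `A` are coordinates for every localization of `A`. -/
theorem IsCoordinateSystem.of_localization (h : IsCoordinateSystem A b β) {A' : Subring K}
    (hle : A ≤ A') (hA' : ∀ a ∈ A', ∃ c ∈ A, ∃ d ∈ A, d ≠ 0 ∧ d⁻¹ ∈ A' ∧ a = c / d) :
    IsCoordinateSystem A' b β where
  mem i := hle (h.mem i)
  eq_D := h.eq_D
  repr_mem i a ha := by
    obtain ⟨c, hc, d, hd, hd0, hdA, rfl⟩ := hA' a ha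
    -- By the quotient rule, the only denominator in a partial derivative of `c / d` is `d ^ 2`.
    rw [← derivationBasis_apply, Derivation.leibniz_div, smul_eq_mul, smul_eq_mul, smul_eq_mul,
      derivationBasis_apply, derivationBasis_apply]
    exact A'.mul_mem (A'.pow_mem hdA _) (A'.sub_mem
      (A'.mul_mem (hle hd) (hle (h.repr_mem i c hc)))
      (A'.mul_mem (hle hc) (hle (h.repr_mem i d hd))))

end Coordinates

/-! ### Pull back of tensors in common coordinates. -/

section Pullback

open Module

variable {k L K : Type*} [Field k] [Field L] [Field K] [Algebra k L] [Algebra k K] [Algebra L K]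
  [IsScalarTower k L K] {ι : Type*} [Fintype ι]
  {b : ι → L} {β : Basis ι L Ω[L⁄k]} {β' : Basis ι K Ω[K⁄k]}

/-- The map on differentials carries the expansion of `da` over `L` to an expansion over `K` in the
corresponding basis. Thus partial derivatives on `K` restrict to those on `L`. -/
theorem repr_D_algebraMap (hβ : ∀ i, β i = KaehlerDifferential.D k L (b i))
    (hβ' : ∀ i, β' i = KaehlerDifferential.D k K (algebraMap L K (b i))) (a : L) (i : ι) :
    β'.repr (KaehlerDifferential.D k K (algebraMap L K a)) i =
      algebraMap L K (β.repr (KaehlerDifferential.D k L a) i) := by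
  classical
  have h1 : KaehlerDifferential.D k K (algebraMap L K a) =
      ∑ j, algebraMap L K (β.repr (KaehlerDifferential.D k L a) j) • β' j := by
    have := congrArg (KaehlerDifferential.map k k L K)
      (β.sum_repr (KaehlerDifferential.D k L a))
    rw [KaehlerDifferential.map_D, map_sum] at this
    rw [← this]
    refine Finset.sum_congr rfl fun j _ => ?_
    rw [map_smul, hβ, KaehlerDifferential.map_D, hβ', algebraMap_smul]
  rw [h1, β'.repr_sum_self]

variable [Algebra.FormallyEtale L K]

/-- A vector field on `K` is determined by its values on the coordinates, and the two sides agree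
there. -/
theorem liftDerivation_derivationBasis (hβ : ∀ i, β i = KaehlerDifferential.D k L (b i))
    (hβ' : ∀ i, β' i = KaehlerDifferential.D k K (algebraMap L K (b i))) (i : ι) :
    liftDerivation k L K (derivationBasis β i) = derivationBasis β' i := by
  classical
  refine (derivationBasis β').ext_elem fun j => ?_
  rw [derivationBasis_repr β' (hβ' j), derivationBasis_repr β' (hβ' j), liftDerivation_algebraMap,
    derivationBasis_apply, derivationBasis_apply, repr_D_algebraMap hβ hβ']

/-- The pull back of tensors preserves the coefficients. -/
theorem tensorBasis_repr_pullbackTensor (hβ : ∀ i, β i = KaehlerDifferential.D k L (b i))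
    (hβ' : ∀ i, β' i = KaehlerDifferential.D k K (algebraMap L K (b i))) {p q : ℕ}
    (t : FieldTensor k L p q) (I : (Fin p → ι) × (Fin q → ι)) :
    (tensorBasis β' p q).repr (pullbackTensor k L K p q t) I =
      algebraMap L K ((tensorBasis β p q).repr t I) := by
  classical
  have h1 (J) : pullbackTensor k L K p q (tensorBasis β p q J) = tensorBasis β' p q J := by
    rw [tensorBasis_apply, tensorBasis_apply, pullbackTensor_tmul]
    simp_rw [liftDerivation_derivationBasis hβ hβ', hβ, KaehlerDifferential.map_D, hβ']
  have h2 : pullbackTensor k L K p q t =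
      ∑ J, algebraMap L K ((tensorBasis β p q).repr t J) • tensorBasis β' p q J := by
    conv_lhs => rw [← (tensorBasis β p q).sum_repr t]
    rw [map_sum]
    refine Finset.sum_congr rfl fun J _ => ?_
    rw [map_smul, h1, algebraMap_smul]
  rw [h2, (tensorBasis β' p q).repr_sum_self]

/-- Regularity of a tensor and of its pull back agree when there are common coordinates. -/
theorem pullbackTensor_mem_regularTensors_iff {B : Subring L} {A : Subring K}
    (hB : IsCoordinateSystem B b β) (hA : IsCoordinateSystem A (fun i => algebraMap L K (b i)) β')
    (hAB : ∀ a, algebraMap L K a ∈ A ↔ a ∈ B) {p q : ℕ} (t : FieldTensor k L p q) :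
    pullbackTensor k L K p q t ∈ regularTensors k A p q ↔ t ∈ regularTensors k B p q := by
  rw [hA.mem_regularTensors_iff, hB.mem_regularTensors_iff]
  simp_rw [tensorBasis_repr_pullbackTensor hB.eq_D hA.eq_D, hAB]

end Pullback

/-! ### Coordinates, flatness and descent of smoothness for local rings. -/

section LocalAlgebra

open Module

/-- A system of coordinates of a ring gives one for its image in the fraction field. -/
theorem exists_isCoordinateSystem_range {k A K ι : Type*} [Field k] [CommRing A] [Field K]
    [Algebra k A] [Algebra k K] [Algebra A K] [IsScalarTower k A K] [IsDomain A]
    [IsFractionRing A K] [Fintype ι]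
    (v : ι → A) (bA : Basis ι A Ω[A⁄k]) (hv : ∀ i, bA i = KaehlerDifferential.D k A (v i)) :
    ∃ β : Basis ι K Ω[K⁄k],
      IsCoordinateSystem (algebraMap A K).range (fun i => algebraMap A K (v i)) β := by
  have : Algebra.FormallyEtale A K := .of_isLocalization (nonZeroDivisors A)
  have H := KaehlerDifferential.isBaseChange_of_formallyEtale k A K
  refine ⟨H.basis bA, fun i => ⟨_, rfl⟩, fun i => ?_, ?_⟩
  · rw [H.basis_apply, hv, KaehlerDifferential.map_D]
  · rintro i _ ⟨a, rfl⟩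
    refine ⟨bA.repr (KaehlerDifferential.D k A a) i, ?_⟩
    rw [← H.basis_repr_comp_apply, KaehlerDifferential.map_D]

/-- Coordinates of a smooth local ring can be chosen among the elements of a subring over which
it is formally étale. -/
theorem exists_basis_kaehlerDifferential (k B A : Type*) [Field k] [CommRing B] [CommRing A]
    [Algebra k B] [Algebra k A] [Algebra B A] [IsScalarTower k B A] [IsLocalRing A]
    [Algebra.FormallySmooth k A] [Algebra.EssFiniteType k A] [Algebra.FormallyUnramified B A] :
    ∃ (n : ℕ) (v : Fin n → B) (bA : Basis (Fin n) A Ω[A⁄k]),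
      ∀ i, bA i = KaehlerDifferential.D k A (algebraMap B A (v i)) := by
  have hspan : Submodule.span A (Set.range fun b : B =>
      KaehlerDifferential.D k A (algebraMap B A b)) = ⊤ := by
    -- Unramifiedness kills `Ω[A⁄B]`, the cokernel of this map.
    have h1 : Function.Surjective (KaehlerDifferential.mapBaseChange k B A) := fun x =>
      (KaehlerDifferential.exact_mapBaseChange_map k B A x).mp (Subsingleton.elim _ _)
    rw [eq_top_iff]
    intro x _
    obtain ⟨y, rfl⟩ := h1 x
    clear * -
    induction y with
    | zero => simp
    | add x y hx hy => rw [map_add]; exact add_mem hx hy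
    | tmul a ω =>
      rw [KaehlerDifferential.mapBaseChange_tmul]
      refine Submodule.smul_mem _ _ ?_
      have := (KaehlerDifferential.span_range_derivation k B).ge (Submodule.mem_top (x := ω))
      induction this using Submodule.span_induction with
      | mem x hx =>
        obtain ⟨b, rfl⟩ := hx
        rw [KaehlerDifferential.map_D]
        exact Submodule.subset_span ⟨b, rfl⟩
      | zero => simp
      | add x y _ _ hx hy => rw [map_add]; exact add_mem hx hy
      | smul r x _ hx =>
        rw [map_smul, ← algebraMap_smul A]
        exact Submodule.smul_mem _ _ hx
  -- Smoothness makes `Ω[A⁄k]` flat; over a local ring a basis can then be selected from any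
  -- spanning family.
  obtain ⟨κ, a, b, hb⟩ := exists_basis_of_span_of_flat _ hspan
  have : Finite κ := Module.Finite.finite_basis b
  cases nonempty_fintype κ
  refine ⟨_, fun i => a ((Fintype.equivFin κ).symm i), b.reindex (Fintype.equivFin κ), fun i => ?_⟩
  rw [Basis.reindex_apply, hb]

/-- A formally smooth algebra is formally étale over the polynomial ring in coordinates. -/
theorem formallyEtale_of_basis_kaehlerDifferential {k A P ι : Type*} [CommRing k] [CommRing A]
    [CommRing P] [Algebra k A] [Algebra k P] [Algebra P A] [IsScalarTower k P A]
    [Algebra.FormallySmooth k A] (bP : Basis ι P Ω[P⁄k]) (bA : Basis ι A Ω[A⁄k])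
    (h : ∀ i, KaehlerDifferential.map k k P A (bP i) = bA i) :
    Algebra.FormallyEtale P A := by
  have hbij : Function.Bijective (KaehlerDifferential.mapBaseChange k P A) := by
    have : KaehlerDifferential.mapBaseChange k P A =
        ((bP.baseChange A).equiv bA (Equiv.refl _)).toLinearMap :=
      (bP.baseChange A).ext fun i => by
        rw [LinearEquiv.coe_coe, Basis.equiv_apply, Basis.baseChange_apply,
          KaehlerDifferential.mapBaseChange_tmul, one_smul, h, Equiv.refl_apply]
    rw [this]
    exact LinearEquiv.bijective _
  refine ⟨⟨fun x y => ?_⟩, ⟨fun x y => ?_⟩⟩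
  · have hs := KaehlerDifferential.map_surjective k P A
    obtain ⟨x, rfl⟩ := hs x
    obtain ⟨y, rfl⟩ := hs y
    rw [(KaehlerDifferential.exact_mapBaseChange_map k P A x).mpr (hbij.2 x),
      (KaehlerDifferential.exact_mapBaseChange_map k P A y).mpr (hbij.2 y)]
  -- In the Jacobi–Zariski sequence this group sits between `H1Cotangent k A`, zero by smoothness,
  -- and the kernel of `mapBaseChange`, zero by `hbij`.
  · have h0 (z : Algebra.H1Cotangent P A) : z = 0 := by
      have h1 : Algebra.H1Cotangent.δ k P A z = 0 := hbij.1 (by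
        rw [map_zero]
        exact (Algebra.H1Cotangent.exact_δ_mapBaseChange k P A _).mpr ⟨z, rfl⟩)
      obtain ⟨w, rfl⟩ := (Algebra.H1Cotangent.exact_map_δ k P A z).mp h1
      rw [Subsingleton.elim w 0, map_zero]
    rw [h0 x, h0 y]

open AlgebraTensorModule in
/-- Flatness descends along faithfully flat extensions of the target. -/
theorem flat_of_faithfullyFlat (R S T : Type*) [CommRing R] [CommRing S] [CommRing T] [Algebra R S]
    [Algebra S T] [Algebra R T] [IsScalarTower R S T] [Module.FaithfullyFlat S T]
    [Module.Flat R T] : Module.Flat R S := by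
  rw [Flat.iff_lTensor_injectiveₛ]
  introv
  have h := (Flat.iff_lTensor_injectiveₛ.mp ‹Module.Flat R T›) N
  rw [← coe_lTensor (A := T), ← EquivLike.injective_comp (cancelBaseChange R S T _ _),
    ← LinearEquiv.coe_coe, ← LinearMap.coe_comp, lTensor_comp_cancelBaseChange,
    LinearMap.coe_comp, LinearEquiv.coe_coe, EquivLike.comp_injective] at h
  rw [← coe_lTensor (A := S)]
  exact (FaithfullyFlat.lTensor_injective_iff_injective S T _).mp h

/-- Formally smooth algebras essentially of finite type over a Noetherian ring are flat. -/
theorem flat_of_formallySmooth (R S : Type*) [CommRing R] [CommRing S] [Algebra R S]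
    [IsNoetherianRing R] [Algebra.EssFiniteType R S] [Algebra.FormallySmooth R S] :
    Module.Flat R S := by
  obtain ⟨S₀, M, _, _⟩ := (Algebra.essFiniteType_iff_exists_subalgebra R S).mp
    ‹Algebra.EssFiniteType R S›
  obtain ⟨n, f, hf⟩ := Algebra.FiniteType.iff_quotient_mvPolynomial''.mp
    (inferInstance : Algebra.FiniteType R S₀)
  -- `S` becomes a quotient of a localized polynomial ring, which is Noetherian and flat over `R`.
  -- Formal smoothness of the quotient transfers the flatness.
  let M' := M.comap f
  let g : Localization M' →ₐ[R] S := IsLocalization.liftAlgHom (M := M')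
    (f := (IsScalarTower.toAlgHom R S₀ S).comp f) fun x => by
      exact IsLocalization.map_units (M := M) S ⟨f x.1, x.2⟩
  have hg : Function.Surjective g := by
    intro x
    obtain ⟨x, ⟨s, hs⟩, rfl⟩ := IsLocalization.exists_mk'_eq M x
    obtain ⟨x, rfl⟩ := hf x
    obtain ⟨s, rfl⟩ := hf s
    have hga (y : MvPolynomial (Fin n) R) :
        g (algebraMap _ (Localization M') y) = algebraMap S₀ S (f y) :=
      IsLocalization.lift_eq _ y
    let s' : M' := ⟨s, hs⟩
    refine ⟨IsLocalization.mk' (M := M') _ x s', ?_⟩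
    rw [IsLocalization.eq_mk'_iff_mul_eq]
    change g _ * algebraMap S₀ S (f (s' : MvPolynomial (Fin n) R)) = _
    rw [← hga, ← hga, ← map_mul, IsLocalization.mk'_spec]
  have : Module.Flat (MvPolynomial (Fin n) R) (Localization M') := IsLocalization.flat _ M'
  have : Module.Flat R (Localization M') := .trans _ (MvPolynomial (Fin n) R) _
  have : IsNoetherianRing (Localization M') := IsLocalization.isNoetherianRing M' _ inferInstance
  exact Algebra.FormallySmooth.flat_of_algHom_of_isNoetherianRing g hg

section

attribute [local instance] Algebra.FormallyEtale.of_formallyUnramified_of_field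

/-- The fibre criterion: for flat algebras smoothness can be tested on the closed fibre, and over a
field an unramified algebra essentially of finite type is étale. -/
theorem formallySmooth_of_flat_of_formallyUnramified (R S : Type*) [CommRing R] [CommRing S]
    [Algebra R S] [IsLocalRing R] [IsLocalRing S] [IsLocalHom (algebraMap R S)]
    [IsNoetherianRing R] [Algebra.EssFiniteType R S] [Module.Flat R S]
    [Algebra.FormallyUnramified R S] : Algebra.FormallySmooth R S := by
  obtain ⟨S₀, M, _, _⟩ := (Algebra.essFiniteType_iff_exists_subalgebra R S).mp
    ‹Algebra.EssFiniteType R S›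
  have : Algebra.FinitePresentation R S₀ := Algebra.FinitePresentation.of_finiteType.mp ‹_›
  have : Algebra.FormallyEtale (IsLocalRing.ResidueField R)
    (IsLocalRing.ResidueField R ⊗[R] S) := inferInstance
  exact Algebra.FormallySmooth.of_formallySmooth_residueField_tensor (P := S₀) M

end

/-- Smoothness descends along formally étale faithfully flat extensions of local rings. -/
theorem formallySmooth_of_formallyEtale_of_faithfullyFlat (k B A : Type*) [Field k] [CommRing B]
    [CommRing A] [Algebra k B] [Algebra k A] [Algebra B A] [IsScalarTower k B A] [IsLocalRing B]
    [IsLocalRing A] [Algebra.FormallySmooth k A] [Algebra.EssFiniteType k A]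
    [Algebra.EssFiniteType k B] [IsNoetherianRing A]
    [Algebra.FormallyEtale B A] [Module.FaithfullyFlat B A] : Algebra.FormallySmooth k B := by
  obtain ⟨n, v, bA, hv⟩ := exists_basis_kaehlerDifferential k B A
  let P := MvPolynomial (Fin n) k
  let : Algebra P B := (MvPolynomial.aeval v).toRingHom.toAlgebra
  have : IsScalarTower k P B := .of_algebraMap_eq' (MvPolynomial.aeval v).comp_algebraMap.symm
  let : Algebra P A := ((algebraMap B A).comp (algebraMap P B)).toAlgebra
  have : IsScalarTower P B A := .of_algebraMap_eq' rfl
  have : IsScalarTower k P A := .of_algebraMap_eq fun x => by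
    rw [IsScalarTower.algebraMap_apply P B A, ← IsScalarTower.algebraMap_apply k P B,
      ← IsScalarTower.algebraMap_apply k B A]
  have : Algebra.FormallyEtale P A :=
    formallyEtale_of_basis_kaehlerDifferential (KaehlerDifferential.mvPolynomialBasis k (Fin n))
      bA fun i => by
        rw [KaehlerDifferential.mvPolynomialBasis_apply, KaehlerDifferential.map_D, hv,
          IsScalarTower.algebraMap_apply P B A]
        congr 2
        exact MvPolynomial.aeval_X v i
  -- `A` is étale over the polynomial ring in coordinates taken from `B`. Localizing at the
  -- contraction `p` makes the map to `B` local; flatness and unramifiedness then descend from `A`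
  -- to `B`, so `B` is smooth over `Pm`.
  let p : Ideal P := (IsLocalRing.maximalIdeal B).comap (algebraMap P B)
  let Pm := Localization.AtPrime p
  let f : Pm →ₐ[P] B := IsLocalization.liftAlgHom (M := p.primeCompl) (f := Algebra.ofId P B)
    fun x => by
      by_contra h
      exact x.2 (Ideal.mem_comap.mpr ((IsLocalRing.mem_maximalIdeal _).mpr h))
  let : Algebra Pm B := f.toRingHom.toAlgebra
  have : IsScalarTower P Pm B := .of_algebraMap_eq' f.comp_algebraMap.symm
  have : IsScalarTower k Pm B := .of_algebraMap_eq fun x => by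
    rw [IsScalarTower.algebraMap_apply k P B, IsScalarTower.algebraMap_apply P Pm B,
      ← IsScalarTower.algebraMap_apply k P Pm]
  let : Algebra Pm A := ((algebraMap B A).comp (algebraMap Pm B)).toAlgebra
  have : IsScalarTower Pm B A := .of_algebraMap_eq' rfl
  have : IsScalarTower P Pm A := .of_algebraMap_eq fun x => by
    rw [IsScalarTower.algebraMap_apply Pm B A, ← IsScalarTower.algebraMap_apply P Pm B,
      ← IsScalarTower.algebraMap_apply P B A]
  have : IsScalarTower k Pm A := .of_algebraMap_eq fun x => by
    rw [IsScalarTower.algebraMap_apply k P A, IsScalarTower.algebraMap_apply P Pm A,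
      ← IsScalarTower.algebraMap_apply k P Pm]
  have : Algebra.FormallyEtale P Pm := .of_isLocalization p.primeCompl
  have : Algebra.FormallyEtale Pm A := .of_restrictScalars (R := P)
  have : Algebra.EssFiniteType Pm A := .of_comp k Pm A
  have : Algebra.EssFiniteType Pm B := .of_comp k Pm B
  have : IsNoetherianRing Pm := IsLocalization.isNoetherianRing p.primeCompl _ inferInstance
  have : Module.Flat Pm A := flat_of_formallySmooth Pm A
  have : Module.Flat Pm B := flat_of_faithfullyFlat Pm B A
  have : Algebra.FormallyUnramified Pm B := by
    refine ⟨?_⟩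
    have e := (KaehlerDifferential.tensorKaehlerEquivOfFormallyEtale Pm B A).subsingleton
    exact (Module.FaithfullyFlat.subsingleton_tensorProduct_iff_right B A).mp e
  have : IsLocalHom (algebraMap Pm B) := by
    refine ⟨fun a ha => ?_⟩
    obtain ⟨x, s, rfl⟩ := IsLocalization.exists_mk'_eq p.primeCompl a
    rw [IsLocalization.AtPrime.isUnit_mk'_iff Pm p]
    intro hx
    refine (IsLocalRing.mem_maximalIdeal _).mp (Ideal.mem_comap.mp hx) ?_
    have h1 := congrArg (algebraMap Pm B) (IsLocalization.mk'_spec' Pm x s)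
    rw [map_mul, ← IsScalarTower.algebraMap_apply P Pm B,
      ← IsScalarTower.algebraMap_apply P Pm B] at h1
    rw [← h1]
    refine IsUnit.mul ?_ ha
    rw [IsScalarTower.algebraMap_apply P Pm B]
    exact (IsLocalization.map_units Pm s).map (algebraMap Pm B)
  have : Algebra.FormallySmooth Pm B := formallySmooth_of_flat_of_formallyUnramified Pm B
  have : Algebra.FormallySmooth k P := inferInstanceAs (Algebra.FormallySmooth k (MvPolynomial _ k))
  have : Algebra.FormallySmooth k Pm := .comp k P Pm
  exact .comp k Pm B

end LocalAlgebra

/-! ### Normality of smooth algebras and extension over codimension two. -/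

/-- Étale extensions of integrally closed domains are integrally closed. -/
theorem isIntegrallyClosed_of_etale (P S : Type*) [CommRing P] [IsDomain P] [IsIntegrallyClosed P]
    [CommRing S] [IsDomain S] [Algebra P S] [Algebra.Etale P S] : IsIntegrallyClosed S := by
  let F := FractionRing P
  let E := S ⊗[P] F
  have hinj : Function.Injective (algebraMap P S) := by
    have : Module.Flat P S := inferInstance
    refine (injective_iff_map_eq_zero _).mpr fun a ha => ?_
    by_contra h
    have h1 : a • (1 : S) = 0 := by rw [Algebra.smul_def, ha, zero_mul]
    exact (smul_eq_zero.mp h1).elim h one_ne_zero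
  have hloc : IsLocalization (Algebra.algebraMapSubmonoid S (nonZeroDivisors P)) E :=
    IsLocalization.tensor _ _ 
  have hM : Algebra.algebraMapSubmonoid S (nonZeroDivisors P) ≤ nonZeroDivisors S := by
    rintro _ ⟨x, hx, rfl⟩
    exact mem_nonZeroDivisors_of_ne_zero
      ((map_ne_zero_iff _ hinj).mpr (nonZeroDivisors.ne_zero hx))
  have : IsDomain E := IsLocalization.isDomain_of_le_nonZeroDivisors (M := Algebra.algebraMapSubmonoid S (nonZeroDivisors P)) E hM
  have : Module.Finite F (F ⊗[P] S) := Algebra.FormallyUnramified.finite_of_free _ _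
  have : Algebra.IsIntegral F (F ⊗[P] S) := inferInstance
  -- A domain finite over the field `F` is a field, so `E` will be the fraction field of `S`.
  have hE : IsField E := by
    have h1 : IsField (F ⊗[P] S) := by
      have : IsDomain (F ⊗[P] S) := (Algebra.TensorProduct.comm P F S).toMulEquiv.isDomain
      exact isField_of_isIntegral_of_isField' (Field.toIsField F)
    exact (Algebra.TensorProduct.comm P F S).toMulEquiv.symm.isField h1
  let _ := hE.toField
  have hinjE : Function.Injective (algebraMap S E) := IsLocalization.injective E hM
  have : FaithfulSMul S E := (faithfulSMul_iff_algebraMap_injective S E).mpr hinjE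
  have : IsFractionRing S E := IsFractionRing.of_field S E fun z => by
    obtain ⟨x, y, rfl⟩ := IsLocalization.exists_mk'_eq
      (Algebra.algebraMapSubmonoid S (nonZeroDivisors P)) z
    refine ⟨x, y, (eq_div_iff ?_).mpr (IsLocalization.mk'_spec E x y)⟩
    exact (map_ne_zero_iff _ hinjE).mpr (nonZeroDivisors.ne_zero (hM y.2))
  refine (isIntegrallyClosed_iff E).mpr fun {x} hx => ?_
  -- Integral closure commutes with smooth base change: elements of `E` integral over `S` come from
  -- `S` tensored with the integral closure of `P` in `F`, which is `P`.
  obtain ⟨t, ht⟩ := (TensorProduct.toIntegralClosure_bijective_of_smooth (R := P) (S := S)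
    (B := F)).2 ⟨x, hx⟩
  replace ht : Algebra.TensorProduct.map (.id S S) (integralClosure P F).val t = x :=
    congr_arg Subtype.val ht
  rw [← ht]
  clear ht
  induction t with
  | zero => exact ⟨0, by simp⟩
  | add a b ha hb =>
    obtain ⟨y, hy⟩ := ha
    obtain ⟨z, hz⟩ := hb
    exact ⟨y + z, by rw [map_add, map_add, hy, hz]⟩
  | tmul s f =>
    obtain ⟨f, hf⟩ := f
    obtain ⟨c, rfl⟩ := (isIntegrallyClosed_iff F).mp ‹_› hf
    refine ⟨c • s, ?_⟩
    have h1 : algebraMap P F c = c • 1 := Algebra.algebraMap_eq_smul_one c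
    change (c • s) ⊗ₜ[P] (1 : F) = s ⊗ₜ[P] (algebraMap P F c)
    rw [h1, TensorProduct.smul_tmul]

/-- Locally a smooth algebra is étale over a polynomial ring, which is normal, and normality can be
checked at maximal ideals. -/
theorem isIntegrallyClosed_of_smooth (k S : Type*) [Field k] [CommRing S] [IsDomain S]
    [Algebra k S] [Algebra.Smooth k S] : IsIntegrallyClosed S := by
  refine .of_localization_maximal fun p _ _ => ?_
  obtain ⟨f, hfp, n, _, _, _⟩ :=
      Algebra.IsSmoothAt.exists_isStandardEtale_mvPolynomial (R := k) (p := p)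
  have hf : f ≠ 0 := fun h => hfp (h ▸ p.zero_mem)
  have : IsDomain (Localization.Away f) := IsLocalization.isDomain_localization
    (powers_le_nonZeroDivisors_of_noZeroDivisors hf)
  have := isIntegrallyClosed_of_etale (MvPolynomial (Fin n) k) (Localization.Away f)
  have hle : Submonoid.powers f ≤ p.primeCompl := by
    rw [Submonoid.powers_le]; exact hfp
  let := (IsLocalization.localizationAlgebraOfSubmonoidLe (Localization.Away f)
    (Localization.AtPrime p) _ _ hle)
  have := IsLocalization.localization_isScalarTower_of_submonoid_le (Localization.Away f)
    (Localization.AtPrime p) _ _ hle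
  have := IsLocalization.isLocalization_of_submonoid_le (Localization.Away f)
    (Localization.AtPrime p) _ _ hle
  refine isIntegrallyClosed_of_isLocalization (R := Localization.Away f) _
    (p.primeCompl.map (algebraMap S (Localization.Away f))) ?_
  rintro _ ⟨x, hx, rfl⟩
  refine mem_nonZeroDivisors_of_ne_zero ((map_ne_zero_iff _ (IsLocalization.injective _
    (powers_le_nonZeroDivisors_of_noZeroDivisors hf))).mpr ?_)
  rintro rfl
  exact hx p.zero_mem

/-- A rational function on a Noetherian normal domain which is defined in codimension one is
regular. -/
theorem mem_range_algebraMap_of_height_le_one (A : Type*) {K : Type*} [CommRing A] [Field K]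
    [Algebra A K] [IsFractionRing A K] [IsDomain A] [IsNoetherianRing A] [IsIntegrallyClosed A]
    (f : K) (h : ∀ p : Ideal A, p.IsPrime → p.height ≤ 1 →
      ∃ s ∉ p, ∃ a, algebraMap A K s * f = algebraMap A K a) :
    f ∈ (algebraMap A K).range := by
  by_contra hf
  let N : Submodule A K := LinearMap.range (Algebra.linearMap A K)
  have hN (x : K) : x ∈ N ↔ x ∈ (algebraMap A K).range := Iff.rfl
  -- If `f` is not in `A`, the annihilator of its class in `K / A` lies in an associated prime `P`,
  -- the ideal of denominators of some `g`. Once `P` has height at most one, the hypothesis gives a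
  -- denominator of `f` outside `P`, a contradiction.
  obtain ⟨P, hP, hle⟩ := exists_le_isAssociatedPrime_of_isNoetherianRing A (N.mkQ f) (by
    simpa [hN] using hf)
  obtain ⟨hPp, y, hy⟩ := isAssociatedPrime_iff.mp hP
  obtain ⟨g, rfl⟩ := N.mkQ_surjective y
  have hmem (c : A) : c ∈ P ↔ ∃ a, algebraMap A K c * g = algebraMap A K a := by
    rw [hy, Submodule.mem_colon_singleton, Submodule.mem_bot, ← map_smul, Submodule.mkQ_apply,
      Submodule.Quotient.mk_eq_zero, hN, Algebra.smul_def]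
    exact ⟨fun ⟨a, ha⟩ => ⟨a, ha.symm⟩, fun ⟨a, ha⟩ => ⟨a, ha.symm⟩⟩
  have hinj := IsFractionRing.injective A K
  have hheight : P.height ≤ 1 := by
    rcases eq_or_ne P ⊥ with hP0 | hP0
    · simp [hP0]
    -- Either some `c * g` with `c ∈ P` avoids `P`, so that `P` is minimal over `c` and Krull's
    -- theorem applies, or `g` maps `P` into itself. Then `g` is integral by Cayley–Hamilton, hence
    -- in `A`, and `P` is not proper.
    by_cases hg : ∃ c ∈ P, ∃ u ∉ P, algebraMap A K c * g = algebraMap A K u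
    · obtain ⟨c, hc, u, hu, h1⟩ := hg
      refine Ideal.height_le_one_of_isPrincipal_of_mem_minimalPrimes (Ideal.span {c}) P
        ⟨⟨hPp, (Ideal.span_singleton_le_iff_mem _).mpr hc⟩, fun Q ⟨hQ, hcQ⟩ hQP d hd => ?_⟩
      obtain ⟨a, ha⟩ := (hmem d).mp hd
      have h2 : d * u = c * a := hinj (by rw [map_mul, map_mul, ← h1, ← ha]; ring)
      refine (hQ.mem_or_mem (x := d) (y := u) ?_).resolve_right fun h3 => hu (hQP h3)
      rw [h2]
      exact Ideal.mul_mem_right _ _ ((Ideal.span_singleton_le_iff_mem _).mp hcQ)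
    · exfalso
      push Not at hg
      refine hPp.ne_top ((Ideal.eq_top_iff_one _).mpr ((hmem 1).mpr ?_))
      have hint : _root_.IsIntegral A g := by
        refine isIntegral_of_smul_mem_submodule (Submodule.map (Algebra.linearMap A K) P) ?_
          ((IsNoetherian.noetherian P).map _) g ?_
        · obtain ⟨c, hc, hc0⟩ := P.ne_bot_iff.mp hP0
          exact (Submodule.ne_bot_iff _).mpr
            ⟨_, ⟨c, hc, rfl⟩, (map_ne_zero_iff _ hinj).mpr hc0⟩
        · rintro _ ⟨c, hc, rfl⟩
          obtain ⟨a, ha⟩ := (hmem c).mp hc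
          refine ⟨a, by_contra fun h2 => hg c hc a h2 ha, ?_⟩
          simp [← ha, mul_comm]
      obtain ⟨a, rfl⟩ := (isIntegrallyClosed_iff K).mp ‹_› hint
      exact ⟨a, by simp⟩
  obtain ⟨s, hs, a, ha⟩ := h P hPp hheight
  refine hs (hle ?_)
  rw [Submodule.mem_colon_singleton, Submodule.mem_bot, ← map_smul, Submodule.mkQ_apply,
    Submodule.Quotient.mk_eq_zero, hN, Algebra.smul_def]
  exact ⟨a, ha.symm⟩

/-! ### Finiteness of representations of bounded dimension. -/

/-- A semisimple ring has finitely many simple modules up to isomorphism. -/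
theorem exists_fin_linearEquiv_of_isSimpleModule (R : Type*) [Ring R] [IsSemisimpleRing R] :
    ∃ (r : ℕ) (T : Fin r → Submodule R R), ∀ (M : Type v) [AddCommGroup M] [Module R M]
      [IsSimpleModule R M], ∃ i, Nonempty (M ≃ₗ[R] T i) := by
  obtain ⟨r, T, e, hT⟩ := IsSemisimpleModule.exists_linearEquiv_fin_dfinsupp R R
  refine ⟨r, T, fun M _ _ _ => ?_⟩
  have := IsSimpleModule.nontrivial R M
  obtain ⟨x, hx⟩ := exists_ne (0 : M)
  let f : R →ₗ[R] M := LinearMap.toSpanSingleton R M x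
  have hf : f.comp e.symm.toLinearMap ≠ 0 := fun h => hx (by
    have := DFunLike.congr_fun h (e 1)
    simpa [f] using this)
  -- A nonzero map from the sum of the `T i` is nonzero on some summand, where Schur's lemma makes
  -- it an isomorphism.
  by_contra hM
  push Not at hM
  refine hf (DFinsupp.lhom_ext' fun i => ?_)
  by_contra h0
  have := hT i
  exact (hM i).false (LinearEquiv.ofBijective _ (LinearMap.bijective_of_ne_zero h0)).symm

/-- Up to isomorphism there are finitely many modules of bounded dimension over a semisimple
algebra. -/
theorem exists_fin_linearEquiv_of_finrank_le (k R : Type*) [Field k] [Ring R] [Algebra k R]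
    [IsSemisimpleRing R] (m : ℕ) {X : Type*} (V : X → Type v) [∀ x, AddCommGroup (V x)]
    [∀ x, Module k (V x)] [∀ x, Module R (V x)] [∀ x, IsScalarTower k R (V x)]
    [∀ x, Module.Finite k (V x)] (hV : ∀ x, Module.finrank k (V x) ≤ m) :
    ∃ (n : ℕ) (c : X → Fin n), ∀ x y, c x = c y → Nonempty (V x ≃ₗ[R] V y) := by
  classical
  obtain ⟨r, T, hT⟩ := exists_fin_linearEquiv_of_isSimpleModule.{v} R
  -- The code `d` records the number of simple summands and the type of each. The number is at most
  -- `m` because each summand has positive dimension.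
  have key (x : X) : ∃ (d : Σ n : Fin (m + 1), Fin n → Fin r),
      Nonempty (V x ≃ₗ[R] Π₀ i : Fin d.1, T (d.2 i)) := by
    have : Module.Finite R (V x) := Module.Finite.of_restrictScalars_finite k R (V x)
    obtain ⟨n, S, e, hS⟩ := IsSemisimpleModule.exists_linearEquiv_fin_dfinsupp R (V x)
    choose j hj using fun i => hT (S i)
    have hn : n ≤ m := by
      refine le_trans ?_ (hV x)
      have : ∀ i, Module.Finite k (S i) := fun i =>
        Module.Finite.of_injective ((S i).subtype.restrictScalars k) Subtype.val_injective
      let e' : V x ≃ₗ[k] (Π i : Fin n, S i) :=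
        (e.trans DFinsupp.linearEquivFunOnFintype).restrictScalars k
      rw [e'.finrank_eq, Module.finrank_pi_fintype]
      calc n = ∑ i : Fin n, 1 := by simp
        _ ≤ _ := Finset.sum_le_sum fun i _ => by
          have := IsSimpleModule.nontrivial R (S i)
          exact Module.finrank_pos
    exact ⟨⟨⟨n, Nat.lt_succ_of_le hn⟩, j⟩,
      ⟨e.trans (DFinsupp.mapRange.linearEquiv fun i => (hj i).some)⟩⟩
  choose d hd using key
  obtain ⟨n, ⟨E⟩⟩ := Finite.exists_equiv_fin (Σ n : Fin (m + 1), Fin n → Fin r)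
  refine ⟨n, fun x => E (d x), fun x y h => ?_⟩
  have hxy : d x = d y := E.injective h
  have hx := hd x
  rw [hxy] at hx
  exact ⟨hx.some.trans (hd y).some.symm⟩

/-- Up to isomorphism there are finitely many representations of bounded dimension of a finite
group in characteristic zero. -/
theorem exists_fin_equivariant_linearEquiv {k H : Type*} [Field k] [CharZero k] [Group H]
    [Finite H] (m : ℕ) {X : Type*} (V : X → Type v) [∀ x, AddCommGroup (V x)]
    [∀ x, Module k (V x)] [∀ x, Module.Finite k (V x)]
    (hV : ∀ x, Module.finrank k (V x) ≤ m) (ρ : ∀ x, Representation k H (V x)) :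
    ∃ (n : ℕ) (c : X → Fin n), ∀ x y, c x = c y →
      ∃ e : V x ≃ₗ[k] V y, ∀ h v, e (ρ x h v) = ρ y h (e v) := by
  -- The condition of Maschke's theorem, which makes the group algebra semisimple.
  have : NeZero (Nat.card H : k) := ⟨Nat.cast_ne_zero.mpr Nat.card_pos.ne'⟩
  obtain ⟨n, c, hc⟩ := exists_fin_linearEquiv_of_finrank_le k (MonoidAlgebra k H) m
    (fun x => (ρ x).asModule) hV
  refine ⟨n, c, fun x y h => ?_⟩
  obtain ⟨e⟩ := hc x y h
  refine ⟨(ρ x).asModuleEquiv.symm ≪≫ₗ e.restrictScalars k ≪≫ₗ (ρ y).asModuleEquiv,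
    fun h v => ?_⟩
  change (ρ y).asModuleEquiv (e ((ρ x).asModuleEquiv.symm (ρ x h v))) =
    ρ y h ((ρ y).asModuleEquiv (e ((ρ x).asModuleEquiv.symm v)))
  rw [Representation.asModuleEquiv_symm_map_rho, map_smul, Representation.asModuleEquiv_map_smul,
    Representation.asAlgebraHom_of]

/-! ### Étale local extensions from free actions, and regularity along them. -/

open scoped Pointwise in
/-- Let a finite group `Γ` act on the fraction field `K` of a normal local domain `A` which is a
localization of the integral closure of a local ring `B` of `Γ`-invariants. If no element of `Γ`
other than `1` preserves `A`, then `A` is flat and formally étale over `B`. -/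
theorem formallyEtale_of_smul_range_le {B A K Γ : Type*} [CommRing B] [IsLocalRing B] [CommRing A]
    [IsDomain A] [IsLocalRing A] [IsIntegrallyClosed A] [Field K] [Algebra A K]
    [IsFractionRing A K] [Algebra B A] [Algebra B K] [IsScalarTower B A K]
    [IsLocalHom (algebraMap B A)] [FaithfulSMul B A] [Group Γ] [Finite Γ] [MulSemiringAction Γ K]
    [SMulCommClass Γ B K]
    (hinv : ∀ a : A, (∀ σ : Γ, σ • algebraMap A K a = algebraMap A K a) →
      ∃ b, algebraMap B K b = algebraMap A K a)
    (hfrac : ∀ a : A, ∃ c d : A, _root_.IsIntegral B c ∧ _root_.IsIntegral B d ∧ IsUnit d ∧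
      a * d = c)
    (hfree : ∀ σ : Γ, (∀ a : A, σ • algebraMap A K a ∈ (algebraMap A K).range) → σ = 1) :
    Algebra.FormallyEtale B A ∧ Module.Flat B A := by
  have hAK := IsFractionRing.injective A K
  -- `Γ` acts on `C` but not on `A`. Normality of `A` puts `C` inside `A`, and `hfrac` makes `A` the
  -- localization of `C` at the contraction `z` of its maximal ideal.
  let C := integralClosure B K
  let e : A ≃+* (algebraMap A K).range :=
    RingEquiv.ofBijective (algebraMap A K).rangeRestrict
      ⟨fun x y h => hAK (congr_arg Subtype.val h), (algebraMap A K).rangeRestrict_surjective⟩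
  have hCA (c : C) : (c : K) ∈ (algebraMap A K).range :=
    (isIntegrallyClosed_iff K).mp ‹_› (IsIntegral.tower_top (A := A) c.2)
  let j : C →+* A := e.symm.toRingHom.comp
    ((Subring.inclusion (S := C.toSubring) (T := (algebraMap A K).range)
      (fun x hx => hCA ⟨x, hx⟩)))
  have hj (c : C) : algebraMap A K (j c) = c := by
    have : e (j c) = ⟨c, hCA c⟩ := e.apply_symm_apply _
    exact congr_arg Subtype.val this
  have hjinj : Function.Injective j := fun x y h => Subtype.ext (by rw [← hj, ← hj, h])
  have hjsurj (a : A) (ha : _root_.IsIntegral B a) : ∃ c, j c = a := by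
    have h1 : _root_.IsIntegral B (algebraMap A K a) := ha.algebraMap
    exact ⟨⟨_, h1⟩, hAK (hj _)⟩
  let := j.toAlgebra
  have : IsScalarTower B C A := .of_algebraMap_eq fun b => hAK (by
    rw [RingHom.algebraMap_toAlgebra, hj, ← IsScalarTower.algebraMap_apply]; rfl)
  let act : MulSemiringAction Γ C :=
    { smul := fun σ c => ⟨σ • (c : K), c.2.map (MulSemiringAction.toAlgHom B K σ)⟩
      one_smul := fun c => Subtype.ext (one_smul _ _)
      mul_smul := fun σ τ c => Subtype.ext (mul_smul _ _ _)
      smul_zero := fun σ => Subtype.ext (smul_zero _)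
      smul_add := fun σ a b => Subtype.ext (smul_add _ _ _)
      smul_one := fun σ => Subtype.ext (smul_one _)
      smul_mul := fun σ a b => Subtype.ext (smul_mul' _ _ _) }
  have hsmul (σ : Γ) (c : C) : ((σ • c : C) : K) = σ • (c : K) := rfl
  have : SMulCommClass Γ B C := ⟨fun σ b c => Subtype.ext (smul_comm σ b (c : K))⟩
  have : Algebra.IsInvariant B C Γ := ⟨fun c hc => by
    obtain ⟨b, hb⟩ := hinv (j c) fun σ => by rw [hj, ← hsmul, hc]
    exact ⟨b, Subtype.ext (by rw [← hj c, ← hb]; rfl)⟩⟩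
  have : FaithfulSMul B C := (faithfulSMul_iff_algebraMap_injective B C).mpr fun x y h => by
    refine FaithfulSMul.algebraMap_injective B A ?_
    rw [IsScalarTower.algebraMap_apply B C A, h, ← IsScalarTower.algebraMap_apply]
  let z : Ideal C := (IsLocalRing.maximalIdeal A).comap j
  have hz (c : C) : c ∉ z ↔ IsUnit (j c) := by simp [z, Ideal.mem_comap]
  have hzB : z.under B = IsLocalRing.maximalIdeal B := by
    rw [Ideal.under_def, Ideal.comap_comap]
    change Ideal.comap ((algebraMap C A).comp (algebraMap B C)) _ = _
    rw [← IsScalarTower.algebraMap_eq]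
    exact ((IsLocalRing.local_hom_TFAE (algebraMap B A)).out 0 4).mp ‹_›
  have hloc : IsLocalization z.primeCompl A :=
    { map_units := fun c => (hz c).mp c.2
      surj := fun a => by
        obtain ⟨_, _, hc, hd, hu, rfl⟩ := hfrac a
        obtain ⟨c, hc⟩ := hjsurj _ hc
        obtain ⟨d, rfl⟩ := hjsurj _ hd
        exact ⟨⟨c, d, (hz d).mpr hu⟩, hc.symm⟩
      exists_of_eq := fun h => ⟨1, by rw [hjinj h]⟩ }
  -- If `σ` acts trivially modulo a maximal ideal `m`, then `m` and `z` lie over the same ideal of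
  -- `B`, so `m = τ • z` by transitivity. The conjugate of `σ` by `τ` acts trivially modulo `z`,
  -- hence preserves the localization `A`, and is `1`.
  have key : ∀ σ : Γ, σ ≠ 1 → Ideal.span (Set.range fun c : C => c - σ • c) = ⊤ := by
    intro σ hσ
    by_contra hne
    obtain ⟨m, hm, hle⟩ := Ideal.exists_le_maximal _ hne
    have hmB : m.under B = IsLocalRing.maximalIdeal B :=
      IsLocalRing.eq_maximalIdeal (Ideal.isMaximal_comap_of_isIntegral_of_isMaximal m)
    obtain ⟨τ, hτ⟩ := Algebra.IsInvariant.exists_smul_of_under_eq B C Γ z m (hzB.trans hmB.symm)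
    have h1 (c : C) : c - (τ⁻¹ * σ * τ) • c ∈ z := by
      have h2 : τ • c - σ • τ • c ∈ τ • z := hτ ▸ hle (Ideal.subset_span ⟨τ • c, rfl⟩)
      rw [Ideal.mem_pointwise_smul_iff_inv_smul_mem] at h2
      simpa [smul_sub, mul_smul] using h2
    have h3 := hfree (τ⁻¹ * σ * τ) fun a => by
      obtain ⟨_, _, hc, hd, hu, rfl⟩ := hfrac a
      obtain ⟨c, hc⟩ := hjsurj _ hc
      obtain ⟨d, rfl⟩ := hjsurj _ hd
      have h4 : IsUnit (j ((τ⁻¹ * σ * τ) • d)) := by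
        rw [← hz]
        intro h5
        exact (hz d).mpr hu (by simpa using z.add_mem (h1 d) h5)
      obtain ⟨w, hw⟩ := h4.exists_left_inv
      refine ⟨w * j ((τ⁻¹ * σ * τ) • c), ?_⟩
      have h6 : algebraMap A K w * ((τ⁻¹ * σ * τ) • (d : K)) = 1 := by
        rw [← hsmul, ← hj, ← map_mul, hw, map_one]
      have h7 : algebraMap A K a * d = c := by rw [← hj, ← hj, ← map_mul, hc]
      rw [map_mul, hj, hsmul, ← h7, smul_mul', mul_left_comm, h6, mul_one]
    exact hσ (by simpa [mul_assoc, inv_mul_eq_one, mul_eq_left] using h3)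
  have := etale_of_free_action (B := B) key
  have : Algebra.FormallyEtale C A := Algebra.FormallyEtale.of_isLocalization z.primeCompl
  have : Module.Flat C A := IsLocalization.flat A z.primeCompl
  exact ⟨.comp B C A, .trans B C A⟩

/-- A fraction of elements of `B` which is regular in a faithfully flat extension `A` belongs
to `B`. -/
theorem algebraMap_mem_range_iff_of_faithfullyFlat {B A L K : Type*} [CommRing B] [CommRing A]
    [IsDomain A] [Field L] [Field K] [Algebra B A] [Algebra B L] [IsFractionRing B L] [Algebra A K]
    [IsFractionRing A K] [Algebra L K] [Algebra B K] [IsScalarTower B A K] [IsScalarTower B L K]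
    [Module.FaithfullyFlat B A] (f : L) :
    algebraMap L K f ∈ (algebraMap A K).range ↔ f ∈ (algebraMap B L).range := by
  constructor
  · rintro ⟨a, ha⟩
    obtain ⟨b, c, hc, rfl⟩ := IsFractionRing.div_surjective B f
    have : Nontrivial B := (algebraMap B L).domain_nontrivial
    have hc0 : algebraMap B L c ≠ 0 := IsFractionRing.to_map_ne_zero_of_mem_nonZeroDivisors hc
    have h1 : algebraMap B A b = algebraMap B A c * a := IsFractionRing.injective A K (by
      rw [map_mul, ha, ← IsScalarTower.algebraMap_apply, ← IsScalarTower.algebraMap_apply,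
        map_div₀, ← IsScalarTower.algebraMap_apply, ← IsScalarTower.algebraMap_apply,
        mul_div_cancel₀]
      rw [IsScalarTower.algebraMap_apply B L K]
      exact (map_ne_zero _).mpr hc0)
    -- Faithful flatness gives `cA ∩ B = cB`, so `c` divides `b` already in `B`.
    have h2 : b ∈ ((Ideal.span {c}).map (algebraMap B A)).comap (algebraMap B A) := by
      rw [Ideal.mem_comap, Ideal.map_span, Set.image_singleton, Ideal.mem_span_singleton]
      exact ⟨a, h1⟩
    rw [Ideal.comap_map_eq_self_of_faithfullyFlat, Ideal.mem_span_singleton] at h2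
    obtain ⟨d, rfl⟩ := h2
    exact ⟨d, by rw [map_mul, mul_div_cancel_left₀ _ hc0]⟩
  · rintro ⟨b, rfl⟩
    exact ⟨algebraMap B A b, by
      rw [← IsScalarTower.algebraMap_apply, ← IsScalarTower.algebraMap_apply]⟩

/-- Elements of `L` whose differentials are a basis for a formally étale extension of `L` have
differentials forming a basis for `L`. -/
theorem exists_basis_kaehlerDifferential_of_formallyEtale {k L K ι : Type*} [Field k] [Field L]
    [Field K] [Algebra k L] [Algebra k K] [Algebra L K] [IsScalarTower k L K]
    [Algebra.FormallyEtale L K] [Module.Finite L Ω[L⁄k]] [Fintype ι] (b : ι → L)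
    (β : Module.Basis ι K Ω[K⁄k])
    (hβ : ∀ i, β i = KaehlerDifferential.D k K (algebraMap L K (b i))) :
    ∃ β' : Module.Basis ι L Ω[L⁄k], ∀ i, β' i = KaehlerDifferential.D k L (b i) := by
  have H := KaehlerDifferential.isBaseChange_of_formallyEtale k L K
  have hli : LinearIndependent L fun i => KaehlerDifferential.D k L (b i) := by
    refine LinearIndependent.of_comp (KaehlerDifferential.map k k L K) ?_
    have : (KaehlerDifferential.map k k L K) ∘ (fun i => KaehlerDifferential.D k L (b i)) = β := by
      ext i
      simp [hβ]
    rw [this]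
    exact β.linearIndependent.restrict_scalars' L
  -- Independence descends; for spanning, dimensions are compared through the base change of
  -- `Ω[L⁄k]` to `K`.
  have hcard : Fintype.card ι = Module.finrank L Ω[L⁄k] := by
    rw [← Module.finrank_eq_card_basis β, ← H.equiv.finrank_eq, Module.finrank_baseChange]
  exact ⟨.mk hli (hli.span_eq_top_of_card_eq_finrank' hcard).ge, fun i => by simp⟩

/-- Regularity of tensors can be tested after a formally étale and flat local extension of the
local ring. -/
theorem pullbackTensor_mem_regularTensors_range_iff {k B A L K : Type*} [Field k] [CommRing B]
    [CommRing A] [Field L] [Field K] [Algebra k B] [Algebra k A] [Algebra k L] [Algebra k K]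
    [Algebra B A] [Algebra B L] [Algebra B K] [Algebra A K] [Algebra L K] [IsScalarTower k B A]
    [IsScalarTower k B L] [IsScalarTower k A K] [IsScalarTower k L K] [IsScalarTower B A K]
    [IsScalarTower B L K] [IsDomain A] [IsFractionRing A K] [IsFractionRing B L] [IsLocalRing B]
    [IsLocalRing A] [IsLocalHom (algebraMap B A)] [Algebra.FormallyEtale L K]
    [Algebra.EssFiniteType k B] [Algebra.EssFiniteType k A] [Algebra.FormallySmooth k A]
    [Algebra.FormallyEtale B A] [Module.Flat B A] (p q : ℕ) (t : FieldTensor k L p q) :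
    pullbackTensor k L K p q t ∈ regularTensors k (algebraMap A K).range p q ↔
      t ∈ regularTensors k (algebraMap B L).range p q := by
  have : Module.FaithfullyFlat B A := Module.FaithfullyFlat.of_flat_of_isLocalHom
  -- Coordinates taken from `B` serve both local rings at once.
  obtain ⟨n, v, bA, hbA⟩ := exists_basis_kaehlerDifferential k B A
  obtain ⟨β, hβ⟩ := exists_isCoordinateSystem_range (K := K) (fun i => algebraMap B A (v i)) bA hbA
  have : Algebra.EssFiniteType B L := .of_isLocalization L (nonZeroDivisors B)
  have : Algebra.EssFiniteType k L := .comp k B L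
  have hv (i) : algebraMap A K (algebraMap B A (v i)) = algebraMap L K (algebraMap B L (v i)) := by
    rw [← IsScalarTower.algebraMap_apply, ← IsScalarTower.algebraMap_apply]
  simp_rw [hv] at hβ
  obtain ⟨β', hβ'⟩ := exists_basis_kaehlerDifferential_of_formallyEtale (k := k)
    (fun i => algebraMap B L (v i)) β hβ.eq_D
  refine pullbackTensor_mem_regularTensors_iff (β := β') (b := fun i => algebraMap B L (v i))
    ⟨fun i => RingHom.mem_range.mpr ⟨_, rfl⟩, hβ', fun i a ha => ?_⟩ hβ
    (fun a => algebraMap_mem_range_iff_of_faithfullyFlat a) t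
  -- The partial derivatives of elements of `B` lie in `A` and in `L`, hence in `B`.
  rw [← algebraMap_mem_range_iff_of_faithfullyFlat (A := A) (K := K),
    ← repr_D_algebraMap hβ' hβ.eq_D]
  exact hβ.repr_mem i _ ((algebraMap_mem_range_iff_of_faithfullyFlat a).mpr ha)

/-! ### Local rings of varieties. -/

section LocalRings

variable {k : Type u} [Field k] (X : Over (Spec (CommRingCat.of k)))

/-- The functions on an open subset of a `k`-scheme are a `k`-algebra. -/
noncomputable instance sectionAlgebra (U : X.left.Opens) : Algebra k Γ(X.left, U) :=
  RingHom.toAlgebra <| CommRingCat.Hom.hom <|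
    (Scheme.ΓSpecIso (CommRingCat.of k)).inv ≫ X.hom.appLE ⊤ U le_top

theorem germ_algebraMap {U : X.left.Opens} (x : X.left) (hx : x ∈ U) (c : k) :
    X.left.presheaf.germ U x hx (algebraMap k Γ(X.left, U) c) =
      algebraMap k (X.left.presheaf.stalk x) c := by
  have : ((Scheme.ΓSpecIso (CommRingCat.of k)).inv ≫ X.hom.appLE ⊤ U le_top) ≫
      X.left.presheaf.germ U x hx = (Scheme.ΓSpecIso (CommRingCat.of k)).inv ≫ X.hom.appTop ≫
        X.left.presheaf.germ ⊤ x (TopologicalSpace.Opens.mem_top x) := by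
    have h1 : X.hom.appLE ⊤ U le_top ≫ X.left.presheaf.germ U x hx =
        X.hom.appTop ≫ X.left.presheaf.germ ⊤ x (TopologicalSpace.Opens.mem_top x) := by
      have h2 := X.left.presheaf.germ_res
        (homOfLE (le_top : U ≤ X.hom ⁻¹ᵁ (⊤ : (Spec (CommRingCat.of k)).Opens))) x hx
      exact congr_arg (X.hom.appTop ≫ ·) h2
    rw [Category.assoc, h1]
  exact DFunLike.congr_fun (CommRingCat.hom_ext_iff.mp this) c

instance isScalarTower_section_stalk {U : X.left.Opens} (x : U) :
    IsScalarTower k Γ(X.left, U) (X.left.presheaf.stalk (x : X.left)) :=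
  .of_algebraMap_eq fun c => (germ_algebraMap X x.1 x.2 c).symm

instance isScalarTower_stalk_functionField [IsIntegral X.left] (x : X.left) :
    IsScalarTower k (X.left.presheaf.stalk x) X.left.functionField :=
  .of_algebraMap_eq fun c => by
    rw [← germ_algebraMap X (U := ⊤) x trivial,
      ← germ_algebraMap X (U := ⊤) (genericPoint X.left) trivial]
    exact (TopCat.Presheaf.germ_stalkSpecializes_apply _ _ _ _).symm

theorem finiteType_section [LocallyOfFiniteType X.hom] {U : X.left.Opens} (hU : IsAffineOpen U) :
    Algebra.FiniteType k Γ(X.left, U) := by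
  have h := X.hom.finiteType_appLE (isAffineOpen_top _) hU le_top
  exact (RingHom.finiteType_respectsIso.cancel_left_isIso
    (Scheme.ΓSpecIso (CommRingCat.of k)).inv (X.hom.appLE ⊤ U le_top)).mpr h

theorem smooth_section [Smooth X.hom] {U : X.left.Opens} (hU : IsAffineOpen U) :
    Algebra.Smooth k Γ(X.left, U) := by
  have h := X.hom.smooth_appLE (isAffineOpen_top _) hU le_top
  exact (RingHom.Smooth.respectsIso.cancel_left_isIso
    (Scheme.ΓSpecIso (CommRingCat.of k)).inv (X.hom.appLE ⊤ U le_top)).mpr h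

variable {X} in
theorem exists_isAffineOpen (x : X.left) (W : X.left.Opens) (hx : x ∈ W) :
    ∃ U : X.left.Opens, IsAffineOpen U ∧ U ≤ W ∧ ∃ x' : U, (x' : X.left) = x := by
  obtain ⟨_, ⟨A, hA, rfl⟩, hxA, hAU⟩ :=
    X.left.isBasis_affineOpens.exists_subset_of_mem_open hx W.isOpen
  exact ⟨A, hA, hAU, ⟨x, hxA⟩, rfl⟩

instance essFiniteType_stalk [LocallyOfFiniteType X.hom] (x : X.left) :
    Algebra.EssFiniteType k (X.left.presheaf.stalk x) := by
  obtain ⟨U, hU, -, x', rfl⟩ := exists_isAffineOpen x ⊤ trivial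
  have := finiteType_section X hU
  have := hU.isLocalization_stalk x'
  have : Algebra.EssFiniteType Γ(X.left, U) (X.left.presheaf.stalk (x' : X.left)) :=
    .of_isLocalization _ (hU.primeIdealOf x').asIdeal.primeCompl
  exact .comp k Γ(X.left, U) (X.left.presheaf.stalk (x' : X.left))

instance isNoetherianRing_stalk [LocallyOfFiniteType X.hom] (x : X.left) :
    IsNoetherianRing (X.left.presheaf.stalk x) :=
  Algebra.EssFiniteType.isNoetherianRing k _

instance formallySmooth_stalk [Smooth X.hom] (x : X.left) :
    Algebra.FormallySmooth k (X.left.presheaf.stalk x) := by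
  obtain ⟨U, hU, -, x', rfl⟩ := exists_isAffineOpen x ⊤ trivial
  have := smooth_section X hU
  have := hU.isLocalization_stalk x'
  have : Algebra.FormallySmooth Γ(X.left, U) (X.left.presheaf.stalk (x' : X.left)) :=
    .of_isLocalization (hU.primeIdealOf x').asIdeal.primeCompl
  exact .comp k Γ(X.left, U) (X.left.presheaf.stalk (x' : X.left))

instance isIntegrallyClosed_stalk [IsIntegral X.left] [Smooth X.hom] (x : X.left) :
    IsIntegrallyClosed (X.left.presheaf.stalk x) := by
  obtain ⟨U, hU, -, x', rfl⟩ := exists_isAffineOpen x ⊤ trivial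
  have := smooth_section X hU
  have : Nonempty U := ⟨x'⟩
  have := hU.isLocalization_stalk x'
  have := isIntegrallyClosed_of_smooth k Γ(X.left, U)
  exact isIntegrallyClosed_of_isLocalization (R := Γ(X.left, U)) 
    (X.left.presheaf.stalk (x' : X.left)) (hU.primeIdealOf x').asIdeal.primeCompl
    (Ideal.primeCompl_le_nonZeroDivisors _)

/-- Smoothness at a point is formal smoothness of the stalk and is an open condition, so the smooth
locus of the structure morphism is the required neighbourhood. -/
theorem mem_smoothLocus_of_formallySmooth [LocallyOfFiniteType X.hom] (x : X.left)
    [Algebra.FormallySmooth k (X.left.presheaf.stalk x)] : x ∈ smoothLocus X := by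
  have h1 : x ∈ X.hom.smoothLocus := by
    obtain ⟨U, hU, -, x', rfl⟩ := exists_isAffineOpen x ⊤ trivial
    rw [Scheme.Hom.mem_smoothLocus,
      formallySmooth_stalkMap_iff ⊤ (isAffineOpen_top _) U hU le_top x'.2]
    let := (X.hom.appLE ⊤ U le_top).hom.toAlgebra
    let g := X.hom.appLE ⊤ U le_top ≫ X.left.presheaf.germ U x'.1 x'.2
    let := g.hom.toAlgebra
    have : IsScalarTower Γ(Spec (CommRingCat.of k), ⊤) Γ(X.left, U)
      (X.left.presheaf.stalk (x' : X.left)) := .of_algebraMap_eq' rfl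
    have := hU.isLocalization_stalk x'
    have hg : g.hom.FormallySmooth := by
      refine (RingHom.FormallySmooth.respectsIso.cancel_left_isIso
        (Scheme.ΓSpecIso (CommRingCat.of k)).inv g).mp ?_
      have h2 : ((Scheme.ΓSpecIso (CommRingCat.of k)).inv ≫ g).hom =
          algebraMap k (X.left.presheaf.stalk (x' : X.left)) :=
        RingHom.ext fun c => germ_algebraMap X x'.1 x'.2 c
      rw [← CommRingCat.hom_comp, h2]
      exact (RingHom.formallySmooth_algebraMap).mpr ‹_›
    have : Algebra.FormallySmooth Γ(Spec (CommRingCat.of k), ⊤)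
      (X.left.presheaf.stalk (x' : X.left)) := hg
    exact (Algebra.FormallySmooth.iff_of_equiv ((IsLocalization.algEquiv
      (hU.primeIdealOf x').asIdeal.primeCompl (X.left.presheaf.stalk (x' : X.left))
      (Localization.AtPrime (hU.primeIdealOf x').asIdeal)).restrictScalars _)).mp this
  refine ⟨X.hom.smoothLocus, h1, Scheme.Hom.smoothLocus_eq_top_iff.mp ?_⟩
  rw [← Scheme.Hom.preimage_smoothLocus_eq]
  simp

theorem smoothLocus_eq_univ [Smooth X.hom] : smoothLocus X = Set.univ :=
  Set.eq_univ_of_forall fun _ => ⟨⊤, trivial, inferInstance⟩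

end LocalRings

/-! ### Local rings inside the function field. -/

section FunctionFields

variable {k : Type u} [Field k] {X Y Z : Over (Spec (CommRingCat.of k))} [IsIntegral X.left]
  [IsIntegral Y.left] [IsIntegral Z.left]

theorem genericPoint_mem {U : X.left.Opens} {x : X.left} (hx : x ∈ U) :
    genericPoint X.left ∈ U :=
  (genericPoint_specializes x).mem_open U.2 hx

theorem mem_localRing_iff {x : X.left} {f : X.left.functionField} :
    f ∈ localRing X x ↔ ∃ (U : X.left.Opens) (hx : x ∈ U) (s : Γ(X.left, U)),
      X.left.presheaf.germ U (genericPoint X.left) (genericPoint_mem hx) s = f := by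
  constructor
  · rintro ⟨a, rfl⟩
    obtain ⟨U, hU, s, rfl⟩ := X.left.presheaf.exists_germ_eq a
    exact ⟨U, hU, s, (X.left.presheaf.germ_stalkSpecializes_apply _ _ _).symm⟩
  · rintro ⟨U, hx, s, rfl⟩
    exact ⟨X.left.presheaf.germ U x hx s, X.left.presheaf.germ_stalkSpecializes_apply _ _ _⟩

/-- A rational function which is defined at all points of an open set is a section. -/
theorem exists_germ_eq_of_forall_mem_localRing (V : X.left.Opens) (hV : genericPoint X.left ∈ V)
    (f : X.left.functionField) (h : ∀ x ∈ V, f ∈ localRing X x) :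
    ∃ s : Γ(X.left, V), X.left.presheaf.germ V (genericPoint X.left) hV s = f := by
  choose U hU s hs using fun x : V => mem_localRing_iff.mp (h x.1 x.2)
  let U' (x : V) : X.left.Opens := U x ⊓ V
  obtain ⟨t, ht, -⟩ := X.left.sheaf.existsUnique_gluing' U' V (fun x => homOfLE inf_le_right)
    (fun x hx => TopologicalSpace.Opens.mem_iSup.mpr ⟨⟨x, hx⟩, hU ⟨x, hx⟩, hx⟩)
    (fun x => X.left.presheaf.map (homOfLE inf_le_left : U' x ⟶ U x).op (s x)) (by
      intro x y
      -- Sections of an integral scheme agree as soon as their germs at the generic point do, which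
      -- gives the gluing condition.
      refine germ_injective_of_isIntegral X.left (genericPoint X.left)
        (show genericPoint X.left ∈ U' x ⊓ U' y from
          ⟨⟨genericPoint_mem (hU x), hV⟩, ⟨genericPoint_mem (hU y), hV⟩⟩) ?_
      erw [TopCat.Presheaf.germ_res_apply, TopCat.Presheaf.germ_res_apply, TopCat.Presheaf.germ_res_apply, TopCat.Presheaf.germ_res_apply]
      rw [hs, hs])
  refine ⟨t, ?_⟩
  have h1 := congr_arg (X.left.presheaf.germ (U' ⟨_, hV⟩) (genericPoint X.left)
    ⟨hU _, hV⟩) (ht ⟨_, hV⟩)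
  erw [TopCat.Presheaf.germ_res_apply, TopCat.Presheaf.germ_res_apply] at h1
  rw [← hs ⟨_, hV⟩, ← h1]

theorem functionFieldHom_algebraMap (φ : X ⟶ Y) (h : DenseRange φ.left) (x : X.left) (y : Y.left)
    (hxy : φ.left x = y) (b : Y.left.presheaf.stalk y) :
    functionFieldHom φ h (algebraMap _ Y.left.functionField b) =
      algebraMap _ X.left.functionField (stalkHom φ x y hxy b) := by
  subst hxy
  obtain ⟨U, hU, s, rfl⟩ := Y.left.presheaf.exists_germ_eq b
  have h1 : algebraMap _ Y.left.functionField (Y.left.presheaf.germ U _ hU s) =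
      Y.left.presheaf.germ U _ (genericPoint_mem hU) s :=
    Y.left.presheaf.germ_stalkSpecializes_apply _ _ _
  have hU' : x ∈ φ.left ⁻¹ᵁ U := hU
  have h2 : stalkHom φ x _ rfl (Y.left.presheaf.germ U _ hU s) =
      X.left.presheaf.germ (φ.left ⁻¹ᵁ U) x hU' (φ.left.app U s) := by
    have : Y.left.presheaf.germ U _ hU ≫ (Y.left.presheaf.stalkSpecializes
        (specializes_of_eq rfl) ≫ φ.left.stalkMap x) = φ.left.app U ≫ X.left.presheaf.germ _ x hU := by
      rw [TopCat.Presheaf.germ_stalkSpecializes_assoc]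
      exact Scheme.Hom.germ_stalkMap φ.left U _ hU
    exact DFunLike.congr_fun (CommRingCat.hom_ext_iff.mp this) s
  have h3 : algebraMap _ X.left.functionField (X.left.presheaf.germ (φ.left ⁻¹ᵁ U) x hU'
      (φ.left.app U s)) = X.left.presheaf.germ (φ.left ⁻¹ᵁ U) _ (genericPoint_mem hU')
        (φ.left.app U s) := X.left.presheaf.germ_stalkSpecializes_apply _ _ _
  rw [h1, h2, h3]
  exact functionFieldHom_germ φ h U _ _ s

theorem functionFieldHom_mem_localRing (φ : X ⟶ Y) (h : DenseRange φ.left) (x : X.left)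
    {f : Y.left.functionField} (hf : f ∈ localRing Y (φ.left x)) :
    functionFieldHom φ h f ∈ localRing X x := by
  obtain ⟨b, rfl⟩ := hf
  exact ⟨_, (functionFieldHom_algebraMap φ h x _ rfl b).symm⟩

theorem functionFieldHom_comp (φ : X ⟶ Y) (ψ : Y ⟶ Z) (hφ : DenseRange φ.left)
    (hψ : DenseRange ψ.left) (h : DenseRange (φ ≫ ψ).left) (f : Z.left.functionField) :
    functionFieldHom (φ ≫ ψ) h f = functionFieldHom φ hφ (functionFieldHom ψ hψ f) := by
  obtain ⟨U, hU, s, rfl⟩ := Z.left.presheaf.exists_germ_eq f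
  have hY : genericPoint Y.left ∈ ψ.left ⁻¹ᵁ U := by
    change ψ.left _ ∈ U
    rwa [map_genericPoint hψ]
  have hX : genericPoint X.left ∈ φ.left ⁻¹ᵁ (ψ.left ⁻¹ᵁ U) := by
    change φ.left _ ∈ ψ.left ⁻¹ᵁ U
    rwa [map_genericPoint hφ]
  erw [functionFieldHom_germ ψ hψ U hU hY, functionFieldHom_germ φ hφ _ hY hX,
    functionFieldHom_germ (φ ≫ ψ) h U hU hX]
  congr 1

theorem functionFieldHom_id (h : DenseRange (𝟙 X : X ⟶ X).left) (f : X.left.functionField) :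
    functionFieldHom (𝟙 X) h f = f := by
  obtain ⟨U, hU, s, rfl⟩ := X.left.presheaf.exists_germ_eq f
  exact functionFieldHom_germ (𝟙 X) h U hU hU s

/-- On a separated scheme, the inclusion of local rings reflects specialization. -/
theorem specializes_of_localRing_le [IsSeparated X.hom] {x x' : X.left}
    (h : localRing X x ≤ localRing X x') : x' ⤳ x := by
  let e : X.left.presheaf.stalk x' ≃+* localRing X x' :=
    RingEquiv.ofBijective
      (algebraMap (X.left.presheaf.stalk x') X.left.functionField).rangeRestrict
      ⟨fun a b h => IsFractionRing.injective _ X.left.functionField (congr_arg Subtype.val h),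
        RingHom.rangeRestrict_surjective _⟩
  let r : X.left.presheaf.stalk x →+* localRing X x :=
    (algebraMap (X.left.presheaf.stalk x) X.left.functionField).rangeRestrict
  let j : X.left.presheaf.stalk x →+* X.left.presheaf.stalk x' :=
    e.symm.toRingHom.comp ((Subring.inclusion h).comp r)
  have hj (a) : algebraMap _ X.left.functionField (j a) = algebraMap _ X.left.functionField a := by
    have : e (j a) = Subring.inclusion h ⟨algebraMap _ _ a, a, rfl⟩ := e.apply_symm_apply _
    exact congr_arg Subtype.val this
  let ι := Spec.map (X.left.presheaf.stalkSpecializes (genericPoint_specializes x'))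
  have : IsDominant ι := ⟨(PrimeSpectrum.denseRange_comap_iff_ker_le_nilRadical _).mpr <| by
    have h1 := (RingHom.injective_iff_ker_eq_bot _).mp
      (IsFractionRing.injective (X.left.presheaf.stalk x') X.left.functionField)
    refine le_of_eq_of_le h1 ?_
    exact bot_le⟩
  have : X.left.IsSeparated :=
    ⟨by rw [← Limits.terminal.comp_from X.hom]; infer_instance⟩
  -- Both morphisms agree at the generic point, hence everywhere, since `X` is separated. So `x'` is
  -- in the image of the spectrum of the stalk at `x`, that is, among the generizations of `x`.
  have h1 : Spec.map (CommRingCat.ofHom j) ≫ X.left.fromSpecStalk x =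
      X.left.fromSpecStalk x' := by
    refine ext_of_isDominant ι ?_
    have h2 : CommRingCat.ofHom j ≫ X.left.presheaf.stalkSpecializes
        (genericPoint_specializes x') =
          X.left.presheaf.stalkSpecializes (genericPoint_specializes x) :=
      CommRingCat.hom_ext (RingHom.ext hj)
    rw [← Spec.map_comp_assoc, h2, Scheme.SpecMap_stalkSpecializes_fromSpecStalk,
      Scheme.SpecMap_stalkSpecializes_fromSpecStalk]
  have h3 : x' ∈ Set.range (X.left.fromSpecStalk x) := by
    rw [← Scheme.fromSpecStalk_closedPoint (x := x'), ← h1]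
    exact ⟨_, rfl⟩
  rwa [Scheme.range_fromSpecStalk] at h3

end FunctionFields

/-! ### The action on points and on rational functions. -/

section Action

variable {k : Type u} [Field k] {G : Type v} [Group G] {X Y : Over (Spec (CommRingCat.of k))}
  (ρ : G →* Aut X)

theorem act_mul_apply (a b : G) (x : X.left) :
    (act ρ (a * b)).left x = (act ρ a).left ((act ρ b).left x) := by
  rw [act_mul, Over.comp_left, Scheme.Hom.comp_apply]

theorem act_one_apply (x : X.left) : (act ρ 1).left x = x := by
  rw [act_one]
  rfl

theorem act_inv_apply_act (g : G) (x : X.left) : (act ρ g⁻¹).left ((act ρ g).left x) = x := by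
  rw [← act_mul_apply, inv_mul_cancel, act_one_apply]

theorem act_apply_act_inv (g : G) (x : X.left) : (act ρ g).left ((act ρ g⁻¹).left x) = x := by
  rw [← act_mul_apply, mul_inv_cancel, act_one_apply]

/-- The homeomorphism of `X` given by an element of `G`. -/
noncomputable def actHomeomorph (g : G) : X.left ≃ₜ X.left where
  toFun := (act ρ g).left
  invFun := (act ρ g⁻¹).left
  left_inv := act_inv_apply_act ρ g
  right_inv := act_apply_act_inv ρ g
  continuous_toFun := (act ρ g).left.continuous
  continuous_invFun := (act ρ g⁻¹).left.continuous

theorem denseRange_act (g : G) : DenseRange (act ρ g).left :=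
  (actHomeomorph ρ g).surjective.denseRange

theorem act_mem_closedPoints (g : G) {x : X.left} (hx : x ∈ closedPoints X.left) :
    (act ρ g).left x ∈ closedPoints X.left := by
  have := (actHomeomorph ρ g).isClosedMap _ hx
  rwa [Set.image_singleton] at this

variable {ρ} in
theorem IsGeometricQuotient.denseRange {π : X ⟶ Y} (h : IsGeometricQuotient ρ π) :
    DenseRange π.left :=
  h.isQuotientMap.surjective.denseRange

variable [IsIntegral X.left]

/-- The action of `G` on the function field of `X`. -/
noncomputable def fieldAction : G →* (X.left.functionField ≃ₐ[k] X.left.functionField) where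
  -- The inverse turns the contravariant pull back of functions into a left action.
  toFun g := AlgEquiv.ofAlgHom (functionFieldHom (act ρ g⁻¹) (denseRange_act ρ _))
    (functionFieldHom (act ρ g) (denseRange_act ρ _))
    (AlgHom.ext fun f => by
      have h : act ρ g⁻¹ ≫ act ρ g = 𝟙 X := by rw [← act_mul, mul_inv_cancel, act_one]
      have h1 : DenseRange (act ρ g⁻¹ ≫ act ρ g).left := by
        rw [← act_mul]; exact denseRange_act ρ _
      rw [AlgHom.comp_apply, ← functionFieldHom_comp _ _ _ _ h1]
      simp_rw [h]
      exact functionFieldHom_id _ f)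
    (AlgHom.ext fun f => by
      have h : act ρ g ≫ act ρ g⁻¹ = 𝟙 X := by rw [← act_mul, inv_mul_cancel, act_one]
      have h1 : DenseRange (act ρ g ≫ act ρ g⁻¹).left := by
        rw [← act_mul]; exact denseRange_act ρ _
      rw [AlgHom.comp_apply, ← functionFieldHom_comp _ _ _ _ h1]
      simp_rw [h]
      exact functionFieldHom_id _ f)
  map_one' := AlgEquiv.ext fun f => by
    have h : act ρ (1 : G)⁻¹ = 𝟙 X := by rw [inv_one, act_one]
    change functionFieldHom (act ρ 1⁻¹) (denseRange_act ρ _) f = f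
    simp_rw [h]
    exact functionFieldHom_id _ f
  map_mul' a b := AlgEquiv.ext fun f => by
    have h : act ρ (a * b)⁻¹ = act ρ a⁻¹ ≫ act ρ b⁻¹ := by rw [mul_inv_rev, act_mul]
    have h1 : DenseRange (act ρ a⁻¹ ≫ act ρ b⁻¹).left := by
      rw [← h]; exact denseRange_act ρ _
    change functionFieldHom (act ρ (a * b)⁻¹) (denseRange_act ρ _) f =
      functionFieldHom (act ρ a⁻¹) (denseRange_act ρ _)
        (functionFieldHom (act ρ b⁻¹) (denseRange_act ρ _) f)
    rw [← functionFieldHom_comp _ _ _ _ h1]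
    simp_rw [h]

theorem fieldAction_mem_localRing (g : G) {x : X.left} {f : X.left.functionField}
    (hf : f ∈ localRing X ((act ρ g⁻¹).left x)) : fieldAction ρ g f ∈ localRing X x :=
  functionFieldHom_mem_localRing _ (denseRange_act ρ _) x hf

theorem fieldAction_inv_apply (g : G) (f : X.left.functionField) :
    fieldAction ρ g⁻¹ f = functionFieldHom (act ρ g) (denseRange_act ρ g) f := by
  change functionFieldHom (act ρ g⁻¹⁻¹) (denseRange_act ρ _) f = _
  simp_rw [inv_inv]

/-- The group acts freely at `x`, up to elements acting trivially on `X`. -/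
def IsFreeAt (x : X.left) : Prop := ∀ g : G, (act ρ g).left x = x → fieldAction ρ g = 1

variable {ρ} {π : X ⟶ Y} [IsIntegral Y.left]

theorem IsGeometricQuotient.fieldAction_functionFieldHom (h : IsGeometricQuotient ρ π) (g : G)
    (f : Y.left.functionField) :
    fieldAction ρ g (functionFieldHom π h.denseRange f) = functionFieldHom π h.denseRange f := by
  have h1 : DenseRange (act ρ g⁻¹ ≫ π).left := by rw [h.invariant]; exact h.denseRange
  change functionFieldHom (act ρ g⁻¹) (denseRange_act ρ _) _ = _
  rw [← functionFieldHom_comp _ _ _ _ h1]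
  simp_rw [h.invariant]

/-- Invariant functions defined at `x` come from functions on the quotient defined at `π x`. -/
theorem IsGeometricQuotient.exists_mem_localRing (h : IsGeometricQuotient ρ π) {x : X.left}
    {f : X.left.functionField} (hf : ∀ g, fieldAction ρ g f = f) (hx : f ∈ localRing X x) :
    ∃ f' ∈ localRing Y (π.left x), functionFieldHom π h.denseRange f' = f := by
  obtain ⟨U, hxU, s, hs⟩ := mem_localRing_iff.mp hx
  -- An invariant function defined on `U` is defined on all translates of `U`. Their union is
  -- saturated, so its image is open and the section descends.
  let W : Set X.left := ⋃ g, (act ρ g).left ⁻¹' U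
  have hW : IsOpen W := isOpen_iUnion fun g => U.isOpen.preimage (act ρ g).left.continuous
  have hsat : π.left ⁻¹' (π.left '' W) = W := by
    refine Set.Subset.antisymm ?_ (Set.subset_preimage_image _ _)
    rintro z ⟨y, hy, hzy⟩
    obtain ⟨a, rfl⟩ := h.orbit y z hzy
    obtain ⟨g, hg⟩ := Set.mem_iUnion.mp hy
    refine Set.mem_iUnion.mpr ⟨g * a⁻¹, ?_⟩
    rwa [Set.mem_preimage, act_mul_apply, act_inv_apply_act]
  let V : Y.left.Opens :=
    ⟨π.left '' W, h.isQuotientMap.isOpen_preimage.mp (by rw [hsat]; exact hW)⟩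
  have hxW : x ∈ W := Set.mem_iUnion.mpr ⟨1, by rwa [Set.mem_preimage, act_one_apply]⟩
  have hxV : x ∈ π.left ⁻¹ᵁ V := ⟨x, hxW, rfl⟩
  have hXV := genericPoint_mem hxV
  obtain ⟨t, ht⟩ := exists_germ_eq_of_forall_mem_localRing (π.left ⁻¹ᵁ V) hXV f fun z hz => by
    have hz' : z ∈ W := hsat ▸ hz
    obtain ⟨g, hg⟩ := Set.mem_iUnion.mp hz'
    rw [← hf g⁻¹]
    refine fieldAction_mem_localRing ρ g⁻¹ (mem_localRing_iff.mpr ⟨U, ?_, s, hs⟩)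
    rwa [inv_inv]
  obtain ⟨r, rfl⟩ := h.surjective V t fun g => by
    refine germ_injective_of_isIntegral X.left _ hXV ?_
    rw [ht]
    conv_rhs => rw [← hf g⁻¹, ← ht]
    have hg : genericPoint X.left ∈ (act ρ g).left ⁻¹ᵁ (π.left ⁻¹ᵁ V) :=
      preimage_le_preimage (h.invariant g) V hXV
    rw [fieldAction_inv_apply, functionFieldHom_germ _ _ _ hXV hg]
    exact X.left.presheaf.germ_res_apply _ _ _ _
  exact ⟨_, mem_localRing_iff.mpr ⟨V, hxV, r, rfl⟩,
    (functionFieldHom_germ π h.denseRange V _ hXV r).trans ht⟩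

end Action

/-! ### The quotient map at free closed points. -/

section Quotients

variable {k : Type u} [Field k] {G : Type v} [Group G] {X Y : Over (Spec (CommRingCat.of k))}
  {ρ : G →* Aut X} {π : X ⟶ Y}

/-- The local ring at a closed point `x` consists of fractions of functions integral over the
local ring of the quotient. -/
theorem IsGeometricQuotient.exists_isIntegralElem [Finite G] [LocallyOfFiniteType X.hom]
    (h : IsGeometricQuotient ρ π) {x : X.left} (hx : x ∈ closedPoints X.left)
    (a : X.left.presheaf.stalk x) :
    ∃ c d : X.left.presheaf.stalk x, (stalkHom π x _ rfl).toRingHom.IsIntegralElem c ∧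
      (stalkHom π x _ rfl).toRingHom.IsIntegralElem d ∧ IsUnit d ∧ a * d = c := by
  obtain ⟨V, hV, -, y, hy⟩ := exists_isAffineOpen (π.left x) ⊤ trivial
  have hxV : x ∈ π.left ⁻¹ᵁ V := by
    change π.left x ∈ V
    rw [← hy]; exact y.2
  obtain ⟨W, hW, hWV, x, rfl⟩ := exists_isAffineOpen x _ hxV
  have : LocallyOfFiniteType π.left := by
    have : LocallyOfFiniteType (π.left ≫ Y.hom) := by rw [Over.w]; infer_instance
    exact locallyOfFiniteType_of_comp π.left Y.hom
  let f := π.left.appLE V W hWV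
  let := f.hom.toAlgebra
  have : Algebra.FiniteType Γ(Y.left, V) Γ(X.left, W) := π.left.finiteType_appLE hV hW hWV
  let q := hW.primeIdealOf x
  let F : PrimeSpectrum Γ(X.left, W) → X.left := fun q' => hW.fromSpec q'
  have hF : Continuous F := hW.fromSpec.continuous
  have hinj : Function.Injective F := hW.fromSpec.isOpenEmbedding.injective
  have hπ (q' : PrimeSpectrum Γ(X.left, W)) : π.left (F q') =
      hV.fromSpec (q'.comap (algebraMap Γ(Y.left, V) Γ(X.left, W))) :=
    (DFunLike.congr_fun (congr_arg (fun φ => φ.base.hom)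
      (IsAffineOpen.SpecMap_appLE_fromSpec π.left hV hW hWV)) q').symm
  have hqx : F q = x := hW.fromSpec_primeIdealOf x
  have horb (q' : PrimeSpectrum Γ(X.left, W))
      (hq' : q'.comap (algebraMap Γ(Y.left, V) Γ(X.left, W)) = q.comap (algebraMap _ _)) :
      ∃ g, (act ρ g).left x = F q' := by
    refine h.orbit _ _ ?_
    rw [hπ, hq', ← hπ, hqx]
  -- The fibre through `q` lies in a finite orbit of closed points, so it is finite and discrete.
  -- This is the quasi-finiteness needed for Zariski's main theorem.
  let Φ := PrimeSpectrum.comap (algebraMap Γ(Y.left, V) Γ(X.left, W)) ⁻¹'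
    {q.comap (algebraMap Γ(Y.left, V) Γ(X.left, W))}
  have hfin : Finite Φ := by
    choose γ hγ using fun q' : Φ => horb q'.1 q'.2
    refine Finite.of_injective γ fun p p' hpp => Subtype.ext (hinj ?_)
    rw [← hγ, ← hγ, hpp]
  have hT : T1Space Φ := by
    refine ⟨fun p => ?_⟩
    obtain ⟨g, hg⟩ := horb p.1 p.2
    have h1 : IsClosed (F ⁻¹' {(act ρ g).left x}) :=
      IsClosed.preimage hF (act_mem_closedPoints ρ g hx)
    convert h1.preimage (continuous_subtype_val (p := (· ∈ Φ)))
    ext p'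
    rw [Set.mem_preimage, Set.mem_preimage, hg, Set.mem_singleton_iff, Set.mem_singleton_iff,
      hinj.eq_iff, Subtype.ext_iff]
  have hqf : Algebra.QuasiFiniteAt Γ(Y.left, V) q.asIdeal :=
    Algebra.QuasiFiniteAt.of_isOpen_singleton_fiber q (isOpen_discrete (α := Φ) _)
  obtain ⟨r, hr, hr', hrs⟩ := Algebra.zariskisMainProperty_iff.mp
    (Algebra.ZariskisMainProperty.of_finiteType (R := Γ(Y.left, V)) q.asIdeal)
  have := hW.isLocalization_stalk x
  obtain ⟨s, t, rfl⟩ := IsLocalization.exists_mk'_eq q.asIdeal.primeCompl a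
  have hyV : π.left x ∈ V := hWV x.2
  have hsq : (stalkHom π (x : X.left) _ rfl).toRingHom.comp
      (Y.left.presheaf.germ V _ hyV).hom = (X.left.presheaf.germ W _ x.2).hom.comp f.hom := by
    have : Y.left.presheaf.germ V _ hyV ≫ (Y.left.presheaf.stalkSpecializes
        (specializes_of_eq rfl) ≫ π.left.stalkMap x) = f ≫ X.left.presheaf.germ W _ x.2 := by
      rw [TopCat.Presheaf.germ_stalkSpecializes_assoc, Scheme.Hom.germ_stalkMap,
        ← X.left.presheaf.germ_res (homOfLE hWV) _ x.2]
      rfl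
    exact CommRingCat.hom_ext_iff.mp this
  have hint (u : Γ(X.left, W)) (hu : _root_.IsIntegral Γ(Y.left, V) u) :
      (stalkHom π (x : X.left) _ rfl).toRingHom.IsIntegralElem
        (algebraMap Γ(X.left, W) (X.left.presheaf.stalk (x : X.left)) u) := by
    obtain ⟨P, hP, hP0⟩ := hu
    refine ⟨P.map (Y.left.presheaf.germ V _ hyV).hom, hP.map _, ?_⟩
    rw [Polynomial.eval₂_map, hsq]
    erw [← Polynomial.hom_eval₂]
    exact (congr_arg _ hP0).trans (map_zero _)
  obtain ⟨m, hm⟩ := hrs s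
  obtain ⟨n, hn⟩ := hrs t
  -- Zariski's main theorem supplies `r` outside `q` whose powers make `s` and `t` integral;
  -- multiplying both by `r ^ (m + n)` leaves the fraction unchanged.
  refine ⟨algebraMap _ _ (r ^ n * (r ^ m * s)), algebraMap _ _ (r ^ m * (r ^ n * t)),
    hint _ ((hr'.pow n).mul hm), hint _ ((hr'.pow m).mul hn), ?_, ?_⟩
  · exact IsLocalization.map_units (X.left.presheaf.stalk (x : X.left))
      (⟨r ^ m * (r ^ n * t), mul_mem (pow_mem hr m) (mul_mem (pow_mem hr n) t.2)⟩ :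
        q.asIdeal.primeCompl)
  · rw [← mul_assoc, map_mul, map_mul, ← mul_assoc, mul_right_comm, IsLocalization.mk'_spec,
      ← map_mul, ← map_mul]
    congr 1
    ring

/-- If an element of `G` preserves the local ring at a closed point `x`, it fixes `x`. -/
theorem act_inv_apply_eq_of_fieldAction_mem [IsIntegral X.left] [IsSeparated X.hom] {x : X.left}
    (hx : x ∈ closedPoints X.left) (g : G)
    (h : ∀ f ∈ localRing X x, fieldAction ρ g f ∈ localRing X x) : (act ρ g⁻¹).left x = x := by
  have hle : localRing X x ≤ localRing X ((act ρ g⁻¹).left x) := fun f hf => by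
    have h1 : fieldAction ρ g⁻¹ (fieldAction ρ g f) ∈ localRing X ((act ρ g⁻¹).left x) :=
      fieldAction_mem_localRing ρ g⁻¹ (by
        rw [inv_inv, act_apply_act_inv]
        exact h f hf)
    have h2 : fieldAction ρ g⁻¹ (fieldAction ρ g f) = f := by
      rw [← AlgEquiv.mul_apply, ← map_mul, inv_mul_cancel, map_one, AlgEquiv.one_apply]
    rwa [h2] at h1
  have h3 := specializes_of_localRing_le hle
  have h4 : IsClosed {(act ρ g⁻¹).left x} := act_mem_closedPoints ρ g⁻¹ hx
  exact (h3.mem_closed h4 rfl).symm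

/-- At a free point the quotient map is étale, and regularity of tensors can be tested on `X`. -/
theorem IsGeometricQuotient.mem_smoothLocus_and_regularTensors_iff [Finite G] [CharZero k]
    [IsVariety X] [IsVariety Y] [Smooth X.hom] (h : IsGeometricQuotient ρ π) {x : X.left}
    (hx : x ∈ closedPoints X.left) (hfree : IsFreeAt ρ x) :
    π.left x ∈ smoothLocus Y ∧ ∀ (p q : ℕ) (τ : RationalTensorField Y p q),
      pullback h.isGenericallyFinite τ ∈ regularTensors k (localRing X x) p q ↔
        τ ∈ regularTensors k (localRing Y (π.left x)) p q := by
  let K := X.left.functionField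
  let L := Y.left.functionField
  let A := X.left.presheaf.stalk x
  let B := Y.left.presheaf.stalk (π.left x)
  let : Algebra B A := (stalkHom π x _ rfl).toRingHom.toAlgebra
  let : Algebra L K := (functionFieldHom π h.isGenericallyFinite.dominant).toRingHom.toAlgebra
  let : Algebra B K := ((algebraMap L K).comp (algebraMap B L)).toAlgebra
  have : IsScalarTower k B A := .of_algebraMap_eq fun a => ((stalkHom π x _ rfl).commutes a).symm
  have : IsScalarTower k L K :=
    .of_algebraMap_eq fun a => ((functionFieldHom π h.denseRange).commutes a).symm
  have : IsScalarTower B L K := .of_algebraMap_eq fun _ => rfl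
  have : IsScalarTower B A K :=
    .of_algebraMap_eq fun b => functionFieldHom_algebraMap π h.denseRange x _ rfl b
  have : CharZero L := charZero_of_injective_algebraMap (algebraMap k L).injective
  have : Algebra.IsIntegral L K := ⟨h.isGenericallyFinite.algebraic⟩
  have : Algebra.FormallyEtale L K := Algebra.FormallyEtale.of_isSeparable _ _
  have : IsLocalHom (algebraMap B A) := isLocalHom_stalkHom π x _ rfl
  have : FaithfulSMul B A := (faithfulSMul_iff_algebraMap_injective B A).mpr fun a b hab => by
    have h1 : algebraMap B K a = algebraMap B K b := by
      rw [IsScalarTower.algebraMap_apply B A K, hab, ← IsScalarTower.algebraMap_apply]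
    exact IsFractionRing.injective B L ((algebraMap L K).injective h1)
  -- Passing to the image removes the elements of `G` that act trivially, as faithfulness is not
  -- assumed.
  let Γ := (fieldAction ρ).range
  have hΓB (σ : Γ) (b : B) : σ • algebraMap B K b = algebraMap B K b := by
    obtain ⟨_, g, rfl⟩ := σ
    exact h.fieldAction_functionFieldHom g _
  have : SMulCommClass Γ B K := ⟨fun σ b f => by
    rw [Algebra.smul_def, Algebra.smul_def, smul_mul', hΓB]⟩
  have : Finite Γ := Set.finite_range (fieldAction ρ)
  obtain ⟨_, _⟩ := formallyEtale_of_smul_range_le (B := B) (A := A) (K := K) (Γ := Γ)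
    (fun a ha => by
      obtain ⟨_, ⟨b, rfl⟩, hb⟩ := h.exists_mem_localRing (f := algebraMap A K a)
        (fun g => ha ⟨_, g, rfl⟩) ⟨a, rfl⟩
      exact ⟨b, hb⟩)
    (fun a => h.exists_isIntegralElem hx a)
    (fun σ hσ => by
      obtain ⟨_, g, rfl⟩ := σ
      have h1 := hfree g⁻¹ (act_inv_apply_eq_of_fieldAction_mem hx g fun f hf => by
        obtain ⟨a, rfl⟩ := hf
        exact hσ a)
      rw [map_inv, inv_eq_one] at h1
      exact Subtype.ext h1)
  have : Module.FaithfullyFlat B A := Module.FaithfullyFlat.of_flat_of_isLocalHom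
  have : Algebra.FormallySmooth k B := formallySmooth_of_formallyEtale_of_faithfullyFlat k B A
  exact ⟨mem_smoothLocus_of_formallySmooth Y _,
    fun p q τ => pullbackTensor_mem_regularTensors_range_iff p q τ⟩

end Quotients

/-! ### Tangent spaces: bounded dimension and stabilizer representations. -/

section TangentSpaces

/-- The cotangent space of a local ring with residue field `k` is generated over `k` by generators
of the maximal ideal. -/
theorem finrank_cotangent_le (k : Type*) {A : Type*} [Field k] [CommRing A] [IsLocalRing A]
    [Algebra k A] (hres : ∀ a : A, ∃ c : k, a - algebraMap k A c ∈ IsLocalRing.maximalIdeal A)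
    {n : ℕ} (v : Fin n → A) (hv : IsLocalRing.maximalIdeal A = Ideal.span (Set.range v)) :
    Module.Finite k (IsLocalRing.maximalIdeal A).Cotangent ∧
      Module.finrank k (IsLocalRing.maximalIdeal A).Cotangent ≤ n := by
  have hmem (i) : v i ∈ IsLocalRing.maximalIdeal A := hv ▸ Ideal.subset_span ⟨i, rfl⟩
  let w (i : Fin n) := (IsLocalRing.maximalIdeal A).toCotangent ⟨v i, hmem i⟩
  have htop : Submodule.span k (Set.range w) = ⊤ := by
    refine eq_top_iff.mpr fun x _ => ?_
    obtain ⟨⟨x, hx⟩, rfl⟩ := Ideal.toCotangent_surjective _ x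
    have hx' := hx
    rw [hv] at hx'
    obtain ⟨a, ha⟩ := (Ideal.mem_span_range_iff_exists_fun).mp hx'
    choose c hc using fun i => hres (a i)
    have h1 : (⟨x, hx⟩ : IsLocalRing.maximalIdeal A) = ∑ i, a i • ⟨v i, hmem i⟩ :=
      Subtype.ext (by simp [← ha])
    have h2 (i) : a i • w i = c i • w i := by
      -- The maximal ideal annihilates the cotangent space, so coefficients may be replaced by their
      -- residues.
      have h3 : (a i - algebraMap k A (c i)) • w i = 0 := by
        rw [← map_smul, Ideal.toCotangent_eq_zero]
        exact (pow_two (IsLocalRing.maximalIdeal A)).symm ▸ Ideal.mul_mem_mul (hc i) (hmem i)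
      rw [sub_smul, sub_eq_zero, algebraMap_smul] at h3
      exact h3
    rw [h1, map_sum]
    refine sum_mem fun i _ => ?_
    rw [map_smul]
    change a i • w i ∈ _
    rw [h2]
    exact Submodule.smul_mem _ _ (Submodule.subset_span ⟨i, rfl⟩)
  have hfin : Module.Finite k (IsLocalRing.maximalIdeal A).Cotangent :=
    ⟨⟨(Set.finite_range w).toFinset, by simpa using htop⟩⟩
  refine ⟨hfin, ?_⟩
  have h := finrank_range_le_card (R := k) w
  rw [Set.finrank, htop, finrank_top, Fintype.card_fin] at h
  exact h

/-- The dimensions of the cotangent spaces at the maximal ideals of an algebra are bounded by the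
number of generators. -/
theorem exists_finrank_cotangent_le (k S : Type*) [Field k] [IsAlgClosed k] [CommRing S]
    [Algebra k S] [Algebra.FiniteType k S] :
    ∃ n : ℕ, ∀ (p : Ideal S) [p.IsMaximal] (A : Type u) [CommRing A] [IsLocalRing A]
      [Algebra S A] [Algebra k A] [IsScalarTower k S A] [IsLocalization.AtPrime A p],
      Module.Finite k (IsLocalRing.maximalIdeal A).Cotangent ∧
        Module.finrank k (IsLocalRing.maximalIdeal A).Cotangent ≤ n := by
  obtain ⟨n, f, hf⟩ := Algebra.FiniteType.iff_quotient_mvPolynomial''.mp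
    ‹Algebra.FiniteType k S›
  refine ⟨n, fun p _ A _ _ _ _ _ _ => ?_⟩
  -- By the Nullstellensatz the residue field is `k`, so `p` is generated by the `n` differences of
  -- the algebra generators and their values.
  have hbij : Function.Bijective (algebraMap k (S ⧸ p)) := by
    let := Ideal.Quotient.field p
    have : Module.Finite k (S ⧸ p) := finite_of_finite_type_of_isJacobsonRing k (S ⧸ p)
    exact IsAlgClosed.algebraMap_bijective_of_isIntegral
  have hp (s : S) : ∃ c : k, s - algebraMap k S c ∈ p := by
    obtain ⟨c, hc⟩ := hbij.2 (Ideal.Quotient.mk p s)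
    refine ⟨c, Ideal.Quotient.eq.mp ?_⟩
    rw [← hc]; rfl
  choose c hc using fun i => hp (f (MvPolynomial.X i))
  let I := Ideal.span (Set.range fun i => f (MvPolynomial.X i) - algebraMap k S (c i))
  have hIp : I ≤ p := Ideal.span_le.mpr (by rintro _ ⟨i, rfl⟩; exact hc i)
  have hI (s : S) : ∃ a : k, s - algebraMap k S a ∈ I := by
    obtain ⟨P, rfl⟩ := hf s
    induction P using MvPolynomial.induction_on with
    | C a => exact ⟨a, by simp [← MvPolynomial.algebraMap_eq]⟩
    | add P Q hP hQ =>
      obtain ⟨a, ha⟩ := hP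
      obtain ⟨b, hb⟩ := hQ
      refine ⟨a + b, ?_⟩
      rw [map_add, map_add, add_sub_add_comm]
      exact add_mem ha hb
    | mul_X P i hP =>
      obtain ⟨a, ha⟩ := hP
      refine ⟨a * c i, ?_⟩
      have : f (P * MvPolynomial.X i) - algebraMap k S (a * c i) =
          f (MvPolynomial.X i) * (f P - algebraMap k S a) +
            algebraMap k S a * (f (MvPolynomial.X i) - algebraMap k S (c i)) := by
        rw [map_mul, map_mul]; ring
      rw [this]
      exact add_mem (I.mul_mem_left _ ha) (I.mul_mem_left _ (Ideal.subset_span ⟨i, rfl⟩))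
  have hpI : p = I := le_antisymm (fun s hs => by
    obtain ⟨a, ha⟩ := hI s
    have h1 : algebraMap k S a ∈ p := by simpa using sub_mem hs (hIp ha)
    have h2 : a = 0 := hbij.1 (by
      rw [map_zero]
      exact Ideal.Quotient.eq_zero_iff_mem.mpr h1)
    simpa [h2] using ha) hIp
  have hmax : IsLocalRing.maximalIdeal A = p.map (algebraMap S A) :=
    (IsLocalization.AtPrime.map_eq_maximalIdeal p A).symm
  refine finrank_cotangent_le k (fun a => ?_)
    (fun i => algebraMap S A (f (MvPolynomial.X i) - algebraMap k S (c i))) ?_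
  · obtain ⟨s, t, rfl⟩ := IsLocalization.exists_mk'_eq p.primeCompl a
    obtain ⟨a, ha⟩ := hp s
    obtain ⟨b, hb⟩ := hp t
    have hb0 : b ≠ 0 := by
      rintro rfl
      exact t.2 (by simpa using hb)
    refine ⟨a / b, ?_⟩
    have hu : IsUnit (algebraMap S A t) := IsLocalization.map_units A t
    rw [← Ideal.unit_mul_mem_iff_mem _ hu, mul_sub, IsLocalization.mk'_spec', hmax,
      IsScalarTower.algebraMap_apply k S A, ← map_mul, ← map_sub]
    refine Ideal.mem_map_of_mem _ ?_
    have h1 : s - t * algebraMap k S (a / b) =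
        s - algebraMap k S a - algebraMap k S (a / b) * (t - algebraMap k S b) := by
      have h2 : algebraMap k S a = algebraMap k S (a / b) * algebraMap k S b := by
        rw [← map_mul, div_mul_cancel₀ _ hb0]
      rw [h2]; ring
    rw [h1]
    exact sub_mem ha (p.mul_mem_left _ hb)
  · rw [hmax, hpI, Ideal.map_span, ← Set.range_comp]
    rfl

variable {k : Type u} [Field k] {G : Type v} [Group G] {X Y Z : Over (Spec (CommRingCat.of k))}
  [IsIntegral X.left] [IsIntegral Y.left] [IsIntegral Z.left]

/-- Local rings inject into function fields, where the identity is `functionFieldHom_comp`. -/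
theorem stalkHom_comp (φ : X ⟶ Y) (ψ : Y ⟶ Z) (hφ : DenseRange φ.left)
    (hψ : DenseRange ψ.left) (h : DenseRange (φ ≫ ψ).left) (x : X.left) (y : Y.left) (z : Z.left)
    (hxy : φ.left x = y) (hyz : ψ.left y = z) (hxz : (φ ≫ ψ).left x = z) (a) :
    stalkHom (φ ≫ ψ) x z hxz a = stalkHom φ x y hxy (stalkHom ψ y z hyz a) := by
  refine IsFractionRing.injective (X.left.presheaf.stalk x) X.left.functionField ?_
  rw [← functionFieldHom_algebraMap _ h, ← functionFieldHom_algebraMap _ hφ,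
    ← functionFieldHom_algebraMap _ hψ, functionFieldHom_comp φ ψ hφ hψ h]

theorem stalkHom_id (x : X.left) (h : (𝟙 X : X ⟶ X).left x = x) (a) :
    stalkHom (𝟙 X) x x h a = a := by
  have hd : DenseRange (𝟙 X : X ⟶ X).left := Function.surjective_id.denseRange
  refine IsFractionRing.injective (X.left.presheaf.stalk x) X.left.functionField ?_
  rw [← functionFieldHom_algebraMap _ hd, functionFieldHom_id]

/-- The representation of a group of elements fixing `x` on the tangent space at `x`. -/
noncomputable def tangentRepresentation (ρ : G →* Aut X) (H : Subgroup G) (x : X.left)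
    (hH : ∀ h ∈ H, (act ρ h).left x = x) : Representation k H (TangentSpaceAt X x) where
  toFun h := differential (act ρ (h : G)) x x (hH h h.2)
  map_one' := by
    refine LinearMap.ext fun l => LinearMap.ext fun t => ?_
    obtain ⟨a, rfl⟩ := Ideal.toCotangent_surjective _ t
    change l (Ideal.mapCotangent _ _ _ _ (Ideal.toCotangent _ a)) = l _
    rw [Ideal.mapCotangent_toCotangent]
    congr 2
    refine Subtype.ext ?_
    have h : act ρ ((1 : H) : G) = 𝟙 X := by rw [OneMemClass.coe_one, act_one]
    change stalkHom (act ρ ((1 : H) : G)) x x (hH _ (1 : H).2) a = a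
    simp_rw [h]
    exact stalkHom_id x _ _
  map_mul' b c := by
    refine LinearMap.ext fun l => LinearMap.ext fun t => ?_
    obtain ⟨a, rfl⟩ := Ideal.toCotangent_surjective _ t
    change l (Ideal.mapCotangent _ _ _ _ (Ideal.toCotangent _ a)) =
      l (Ideal.mapCotangent _ _ _ _ (Ideal.mapCotangent _ _ _ _ (Ideal.toCotangent _ a)))
    simp_rw [Ideal.mapCotangent_toCotangent]
    congr 2
    refine Subtype.ext ?_
    have h : act ρ ((b * c : H) : G) = act ρ (c : G) ≫ act ρ (b : G) := by
      rw [Subgroup.coe_mul, act_mul]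
    have hd : DenseRange (act ρ (c : G) ≫ act ρ (b : G)).left := by
      rw [← h]; exact denseRange_act ρ _
    change stalkHom (act ρ ((b * c : H) : G)) x x (hH _ (b * c).2) a =
      stalkHom (act ρ (c : G)) x x (hH _ c.2) (stalkHom (act ρ (b : G)) x x (hH _ b.2) a)
    simp_rw [h]
    exact stalkHom_comp _ _ (denseRange_act ρ _) (denseRange_act ρ _) hd x x x _ _ _ _

end TangentSpaces

/-! ### Codimension zero means density. -/

section Codimension

variable {Z : Scheme.{u}}

theorem codim_le_coheight {S : Set Z} {z : Z} (hz : z ∈ closure S) : codim S ≤ Order.coheight z :=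
  iInf₂_le z hz

theorem coheight_genericPoint [IsIntegral Z] : Order.coheight (genericPoint Z) = 0 :=
  Order.coheight_eq_zero.mpr fun z _ => genericPoint_specializes z

/-- A zero infimum in `ℕ∞` is attained, and only the generic point has coheight zero. -/
theorem codim_eq_zero_iff [IsIntegral Z] {S : Set Z} :
    codim S = 0 ↔ genericPoint Z ∈ closure S := by
  refine ⟨fun h => ?_, fun h => ?_⟩
  · obtain ⟨z, hz⟩ := ENat.iInf_eq_zero.mp h
    obtain ⟨hzS, hz⟩ := ENat.iInf_eq_zero.mp hz
    exact (Order.coheight_eq_zero.mp hz (genericPoint_specializes z)).mem_closed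
      isClosed_closure hzS
  · exact le_antisymm ((codim_le_coheight h).trans coheight_genericPoint.le) zero_le

theorem dense_iff_genericPoint_mem [IsIntegral Z] {S : Set Z} :
    Dense S ↔ genericPoint Z ∈ closure S :=
  ⟨fun h => h _, fun h z => (genericPoint_specializes z).mem_closed isClosed_closure h⟩

end Codimension

/-! ### Strata: freeness, images in the quotient, finiteness. -/

section Strata

variable {k : Type u} [Field k] {G : Type v} [Group G] {X Y : Over (Spec (CommRingCat.of k))}
  {ρ : G →* Aut X} {π : X ⟶ Y}

/-- Endomorphisms fixing a dense set of closed points are trivial. -/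
theorem eq_id_of_dense [IsAlgClosed k] [IsVariety X] (φ : X ⟶ X) {S : Set X.left}
    (hS : Dense S) (hclosed : S ⊆ closedPoints X.left) (h : ∀ x ∈ S, φ.left x = x) :
    φ = 𝟙 X := by
  have hw : φ.left ≫ X.hom = 𝟙 _ ≫ X.hom := by rw [Over.w φ, Category.id_comp]
  refine Over.OverMorphism.ext (ext_of_fromSpecResidueField_eq φ.left (𝟙 X.left) X.hom S hS
    (fun x hx => ?_) hw)
  -- The residue field of a closed point is `k`, and a `k`-morphism from `Spec k` is determined by
  -- the point it hits.
  rw [← cancel_epi (Spec.map (residueFieldIsoBase X.hom x (hclosed hx)).hom)]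
  have hp (a) : φ.left (X.left.fromSpecResidueField x a) = X.left.fromSpecResidueField x a := by
    rw [Scheme.fromSpecResidueField_apply]
    exact h x hx
  refine ext_of_apply_closedPoint_eq X.hom ?_ ?_ (hp _) <;>
    simp only [Category.assoc, hw, Category.id_comp,
      ← SpecMap_residueFieldIsoBase_inv X.hom x (hclosed hx), ← Spec.map_comp,
      Iso.inv_hom_id, Spec.map_id]

/-- The group acts freely along the dense strata. -/
theorem IsStratum.isFreeAt [IsAlgClosed k] [Finite G] [IsVariety X] {S : Set X.left}
    (hS : IsStratum ρ S) (hd : genericPoint X.left ∈ closure S) {x : X.left} (hx : x ∈ S) :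
    IsFreeAt ρ x := by
  obtain ⟨x₁, -, rfl⟩ := hS
  -- Finitely many translates of `F` cover the stratum, so the generic point, being fixed by `G`,
  -- lies in the closure of `F` itself.
  let F : Set X.left :=
    {z | z ∈ closedPoints X.left ∧ ∀ h, (act ρ h).left z = z ↔ (act ρ h).left x₁ = x₁}
  have hle : {x' | x' ∈ closedPoints X.left ∧ SameType ρ x' x₁} ⊆
      ⋃ g : G, actHomeomorph ρ g ⁻¹' F := by
    rintro x' ⟨hx', g, _, rfl, hz, -⟩
    exact Set.mem_iUnion.mpr ⟨g, act_mem_closedPoints ρ g hx', hz⟩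
  have h1 := closure_mono hle hd
  rw [closure_iUnion_of_finite, Set.mem_iUnion] at h1
  obtain ⟨g, hg⟩ := h1
  rw [← (actHomeomorph ρ g).preimage_closure] at hg
  have h2 : (act ρ g).left (genericPoint X.left) ∈ closure F := hg
  rw [map_genericPoint (denseRange_act ρ g)] at h2
  have hF : Dense F := dense_iff_genericPoint_mem.mpr h2
  have h3 (a : G) (ha : (act ρ a).left x₁ = x₁) : ρ a = 1 :=
    Iso.ext (eq_id_of_dense (act ρ a) hF (fun z hz => hz.1) fun z hz => (hz.2 a).mpr ha)
  obtain ⟨-, b, _, rfl, hz, -⟩ := hx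
  intro a ha
  have h4 : ρ (b * a * b⁻¹) = 1 := h3 _ ((hz _).mp (by
    rw [act_mul_apply, act_mul_apply, act_inv_apply_act, ha]))
  have h5 : ρ a⁻¹ = 1 := by
    rw [map_mul, map_mul, map_inv, mul_inv_eq_one] at h4
    rw [map_inv, inv_eq_one]
    exact mul_eq_left.mp h4
  have h6 : act ρ a⁻¹ = 𝟙 X := by
    unfold act
    rw [h5]
    rfl
  refine AlgEquiv.ext fun f => ?_
  change functionFieldHom (act ρ a⁻¹) (denseRange_act ρ _) f = f
  simp_rw [h6]
  exact functionFieldHom_id _ _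

/-- A stratum of the quotient of codimension `0` is the image of a dense stratum. -/
theorem IsGeometricQuotient.genericPoint_mem_closure [Finite G] [IsIntegral X.left]
    [IsIntegral Y.left] (h : IsGeometricQuotient ρ π) {S : Set X.left} :
    genericPoint Y.left ∈ closure (π.left '' S) ↔ genericPoint X.left ∈ closure S := by
  refine ⟨fun hY => ?_, fun hX => ?_⟩
  · let C : Set X.left := ⋃ g : G, actHomeomorph ρ g ⁻¹' closure S
    have hC : IsClosed C := isClosed_iUnion_of_finite fun g =>
      isClosed_closure.preimage (actHomeomorph ρ g).continuous
    have hsat : π.left ⁻¹' (π.left '' C) = C := by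
      refine Set.Subset.antisymm ?_ (Set.subset_preimage_image _ _)
      rintro x ⟨y, hy, hxy⟩
      obtain ⟨a, rfl⟩ := h.orbit x y hxy.symm
      obtain ⟨g, hg⟩ := Set.mem_iUnion.mp hy
      refine Set.mem_iUnion.mpr ⟨g * a, ?_⟩
      change (act ρ (g * a)).left x ∈ closure S
      rw [act_mul_apply]
      exact hg
    have hπC : IsClosed (π.left '' C) := h.isQuotientMap.isClosed_preimage.mp (by rwa [hsat])
    have hSC : S ⊆ C := fun x hx => Set.mem_iUnion.mpr ⟨1, by
      change (act ρ 1).left x ∈ closure S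
      rw [act_one_apply]
      exact subset_closure hx⟩
    have h1 : genericPoint Y.left ∈ π.left '' C :=
      closure_minimal (Set.image_mono hSC) hπC hY
    rw [← map_genericPoint h.denseRange] at h1
    have h2 : genericPoint X.left ∈ C := hsat ▸ h1
    obtain ⟨g, hg⟩ := Set.mem_iUnion.mp h2
    have h3 : (act ρ g).left (genericPoint X.left) ∈ closure S := hg
    rwa [map_genericPoint (denseRange_act ρ g)] at h3
  · rw [← map_genericPoint h.denseRange]
    exact image_closure_subset_closure_image π.left.continuous ⟨_, hX, rfl⟩

/-- The elements of `G` fixing a point. -/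
def pointStabilizer (ρ : G →* Aut X) (x : X.left) : Subgroup G where
  carrier := {g | (act ρ g).left x = x}
  one_mem' := act_one_apply ρ x
  mul_mem' {a b} ha hb := by
    change (act ρ (a * b)).left x = x
    rw [act_mul_apply, show (act ρ b).left x = x from hb, show (act ρ a).left x = x from ha]
  inv_mem' {a} ha := by
    change (act ρ a⁻¹).left x = x
    conv_lhs => rw [← show (act ρ a).left x = x from ha]
    exact act_inv_apply_act ρ a x

/-- An affine open subset meets finitely many strata. -/
theorem exists_finite_strata [IsAlgClosed k] [CharZero k] [Finite G] [IsVariety X]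
    (ρ : G →* Aut X) {U : X.left.Opens} (hU : IsAffineOpen U) :
    ∃ T : Set (Set X.left), T.Finite ∧ (∀ S ∈ T, IsStratum ρ S) ∧
      (U : Set X.left) ∩ closedPoints X.left ⊆ ⋃₀ T := by
  have := finiteType_section X hU
  obtain ⟨m, hm⟩ := exists_finrank_cotangent_le.{u} k Γ(X.left, U)
  -- For each of the finitely many `H`, the tangent spaces at points of `P H` are representations of
  -- `H` of dimension at most `m`, with finitely many isomorphism classes.
  let P (H : Subgroup G) :=
    {x : U // (x : X.left) ∈ closedPoints X.left ∧ pointStabilizer ρ (x : X.left) = H}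
  have hfin (H : Subgroup G) (x : P H) :
      Module.Finite k (IsLocalRing.maximalIdeal (X.left.presheaf.stalk (x.1 : X.left))).Cotangent ∧
        Module.finrank k
          (IsLocalRing.maximalIdeal (X.left.presheaf.stalk (x.1 : X.left))).Cotangent ≤ m := by
    have := hU.isLocalization_stalk x.1
    have := hU.primeIdealOf_isMaximal_of_isClosed x.1 x.2.1
    exact hm (hU.primeIdealOf x.1).asIdeal _
  have (H : Subgroup G) (x : P H) := (hfin H x).1
  have key (H : Subgroup G) := exists_fin_equivariant_linearEquiv (k := k) (H := H) m
    (fun x : P H => TangentSpaceAt X (x.1 : X.left))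
    (fun x => Subspace.dual_finrank_eq.trans_le (hfin H x).2)
    (fun x => tangentRepresentation ρ H x.1 fun h hh => by
      rw [← x.2.2] at hh
      exact hh)
  choose n c hc using key
  have hsame (H : Subgroup G) (x y : P H) (hxy : c H x = c H y) :
      SameType ρ (x.1 : X.left) (y.1 : X.left) := by
    obtain ⟨e, he⟩ := hc H x y hxy
    refine ⟨1, x.1, act_one_apply ρ _, fun h => ?_, e, fun h hx hy v => ?_⟩
    · exact (SetLike.ext_iff.mp (x.2.2.trans y.2.2.symm) h)
    · exact he ⟨h, x.2.2 ▸ hx⟩ v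
  -- Only the pairs of stabilizer and class that occur are kept, so each has a representative `r i`.
  let I := {i : Σ H : Subgroup G, Fin (n H) // ∃ x : P i.1, c i.1 x = i.2}
  choose r hr using fun i : I => i.2
  refine ⟨Set.range fun i : I =>
    {x' | x' ∈ closedPoints X.left ∧ SameType ρ x' ((r i).1 : X.left)}, Set.finite_range _,
    ?_, ?_⟩
  · rintro _ ⟨i, rfl⟩
    exact ⟨_, (r i).2.1, rfl⟩
  · rintro x ⟨hxU, hx⟩
    let x' : P (pointStabilizer ρ x) := ⟨⟨x, hxU⟩, hx, rfl⟩
    let i : I := ⟨⟨pointStabilizer ρ x, c _ x'⟩, x', rfl⟩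
    exact ⟨_, ⟨i, rfl⟩, hx, hsame _ x' (r i) (hr i).symm⟩

end Strata

/-! ### Regularity of tensors in codimension one implies regularity. -/

section Extension

variable {k : Type u} [Field k] {X : Over (Spec (CommRingCat.of k))} [IsIntegral X.left]

theorem localRing_le_of_specializes {x x' : X.left} (h : x' ⤳ x) :
    localRing X x ≤ localRing X x' := fun f hf => by
  obtain ⟨U, hx, s, rfl⟩ := mem_localRing_iff.mp hf
  exact mem_localRing_iff.mpr ⟨U, h.mem_open U.isOpen hx, s, rfl⟩

/-- Functions defined at a point of an affine open subset are fractions of sections. -/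
theorem exists_eq_germ_div {U : X.left.Opens} (hU : IsAffineOpen U) (x : U)
    {f : X.left.functionField} (hf : f ∈ localRing X (x : X.left)) :
    ∃ s t : Γ(X.left, U), t ∉ (hU.primeIdealOf x).asIdeal ∧
      X.left.presheaf.germ U _ (genericPoint_mem x.2) t ≠ 0 ∧
      (X.left.presheaf.germ U _ (genericPoint_mem x.2) t)⁻¹ ∈ localRing X (x : X.left) ∧
      f = X.left.presheaf.germ U _ (genericPoint_mem x.2) s /
        X.left.presheaf.germ U _ (genericPoint_mem x.2) t := by
  have := hU.isLocalization_stalk x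
  obtain ⟨a, rfl⟩ := hf
  obtain ⟨s, t, rfl⟩ := IsLocalization.exists_mk'_eq (hU.primeIdealOf x).asIdeal.primeCompl a
  have hgerm (r : Γ(X.left, U)) : X.left.presheaf.germ U _ (genericPoint_mem x.2) r =
      algebraMap (X.left.presheaf.stalk (x : X.left)) X.left.functionField
        (algebraMap Γ(X.left, U) (X.left.presheaf.stalk (x : X.left)) r) :=
    (TopCat.Presheaf.germ_stalkSpecializes_apply _ _ _ _).symm
  have hu : IsUnit (algebraMap Γ(X.left, U) (X.left.presheaf.stalk (x : X.left)) t) :=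
    IsLocalization.map_units _ t
  have h0 : X.left.presheaf.germ U _ (genericPoint_mem x.2) (t : Γ(X.left, U)) ≠ 0 := by
    rw [hgerm]
    exact (hu.map _).ne_zero
  refine ⟨s, t, t.2, h0, ?_, ?_⟩
  · obtain ⟨v, hv⟩ := hu
    refine ⟨↑v⁻¹, ?_⟩
    rw [hgerm, ← hv, ← mul_eq_one_iff_eq_inv₀ (v.isUnit.map _).ne_zero, ← map_mul,
      Units.inv_mul, map_one]
  · rw [eq_div_iff h0, hgerm, hgerm, ← map_mul, IsLocalization.mk'_spec]

/-- At every point of a smooth variety there are local coordinates. -/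
theorem exists_isCoordinateSystem [LocallyOfFiniteType X.hom] [Smooth X.hom] (x : X.left) :
    ∃ (n : ℕ) (b : Fin n → X.left.functionField)
      (β : Module.Basis (Fin n) X.left.functionField (Ω[X.left.functionField⁄k])),
      IsCoordinateSystem (localRing X x) b β := by
  obtain ⟨n, v, bA, hv⟩ := exists_basis_kaehlerDifferential k (X.left.presheaf.stalk x)
    (X.left.presheaf.stalk x)
  obtain ⟨β, hβ⟩ := exists_isCoordinateSystem_range (K := X.left.functionField) v bA hv
  exact ⟨n, _, β, hβ⟩

/-- Local coordinates at a point are local coordinates at its generizations. -/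
theorem IsCoordinateSystem.of_specializes {ι : Type*} [Fintype ι] {b : ι → X.left.functionField}
    {β : Module.Basis ι X.left.functionField (Ω[X.left.functionField⁄k])} {x x' : X.left}
    (hβ : IsCoordinateSystem (localRing X x) b β) (h : x' ⤳ x) :
    IsCoordinateSystem (localRing X x') b β := by
  refine hβ.of_localization (localRing_le_of_specializes h) fun f hf => ?_
  obtain ⟨U, hU, -, x, rfl⟩ := exists_isAffineOpen x ⊤ trivial
  have hx' : x' ∈ U := h.mem_open U.isOpen x.2
  obtain ⟨s, t, -, h0, hinv, heq⟩ := exists_eq_germ_div hU ⟨x', hx'⟩ hf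
  exact ⟨_, mem_localRing_iff.mpr ⟨U, x.2, s, rfl⟩, _, mem_localRing_iff.mpr ⟨U, x.2, t, rfl⟩,
    h0, hinv, heq⟩

/-- Coordinates at `x` remain coordinates at `x'`, whose local ring is larger. -/
theorem mem_regularTensors_of_specializes [LocallyOfFiniteType X.hom] [Smooth X.hom]
    {x x' : X.left} (h : x' ⤳ x) {p q : ℕ} {t : RationalTensorField X p q}
    (ht : t ∈ regularTensors k (localRing X x) p q) :
    t ∈ regularTensors k (localRing X x') p q := by
  obtain ⟨n, b, β, hβ⟩ := exists_isCoordinateSystem x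
  rw [(hβ.of_specializes h).mem_regularTensors_iff]
  exact fun I => localRing_le_of_specializes h ((hβ.mem_regularTensors_iff t).mp ht I)

/-- A function defined in codimension one is defined everywhere. -/
theorem mem_localRing_of_coheight_le_one [LocallyOfFiniteType X.hom] [Smooth X.hom] (x : X.left)
    {f : X.left.functionField}
    (hf : ∀ x' : X.left, x' ⤳ x → Order.coheight x' ≤ 1 → f ∈ localRing X x') :
    f ∈ localRing X x := by
  obtain ⟨U, hU, -, x, rfl⟩ := exists_isAffineOpen x ⊤ trivial
  have := hU.isLocalization_stalk x
  refine mem_range_algebraMap_of_height_le_one _ f fun p hp hp1 => ?_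
  -- A prime of the stalk at `x` corresponds to a generization `x'` of `x`, and its height is the
  -- coheight of `x'`.
  let q : PrimeSpectrum Γ(X.left, U) := ⟨p.under Γ(X.left, U), inferInstance⟩
  have hx'U : hU.fromSpec q ∈ U := by
    have : hU.fromSpec q ∈ Set.range hU.fromSpec := ⟨q, rfl⟩
    rwa [hU.range_fromSpec] at this
  obtain ⟨x', hx'⟩ : ∃ x' : U, (x' : X.left) = hU.fromSpec q := ⟨⟨_, hx'U⟩, rfl⟩
  have hq : hU.primeIdealOf x' = q := by
    refine hU.fromSpec.isOpenEmbedding.injective ?_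
    rw [hU.fromSpec_primeIdealOf, hx']
  have hle : q ≤ hU.primeIdealOf x := by
    intro a ha
    by_contra hax
    exact hp.ne_top (p.eq_top_of_isUnit_mem ha (IsLocalization.map_units _
      (⟨a, hax⟩ : (hU.primeIdealOf x).asIdeal.primeCompl)))
  have hspec : (x' : X.left) ⤳ x := by
    rw [← hU.fromSpec_primeIdealOf x, hx']
    exact ((PrimeSpectrum.le_iff_specializes _ _).mp hle).map hU.fromSpec.continuous
  have hcoh : Order.coheight (x' : X.left) ≤ 1 := by
    have := hU.isLocalization_stalk x'
    have h1 := ringKrullDim_stalk_eq_coheight (x' : X.left)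
    rw [IsLocalization.AtPrime.ringKrullDim_eq_height (hU.primeIdealOf x').asIdeal, hq] at h1
    have h2 : q.asIdeal.height = p.height :=
      IsLocalization.height_under (hU.primeIdealOf x).asIdeal.primeCompl p
    rw [h2] at h1
    rw [← WithBot.coe_inj.mp h1]
    exact hp1
  obtain ⟨s, t, ht, h0, -, heq⟩ := exists_eq_germ_div hU x' (hf x' hspec hcoh)
  have hgerm (r : Γ(X.left, U)) : X.left.presheaf.germ U _ (genericPoint_mem x.2) r =
      algebraMap (X.left.presheaf.stalk (x : X.left)) X.left.functionField
        (algebraMap Γ(X.left, U) (X.left.presheaf.stalk (x : X.left)) r) :=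
    (TopCat.Presheaf.germ_stalkSpecializes_apply _ _ _ _).symm
  refine ⟨algebraMap Γ(X.left, U) _ t, ?_, algebraMap Γ(X.left, U) _ s, ?_⟩
  · rw [hq] at ht
    exact ht
  · rw [← hgerm, ← hgerm, heq, mul_div_cancel₀ _ h0]

/-- A tensor field which is regular in codimension one is regular. -/
theorem mem_regularTensors_of_coheight_le_one [LocallyOfFiniteType X.hom] [Smooth X.hom]
    (x : X.left) {p q : ℕ} {t : RationalTensorField X p q}
    (ht : ∀ x' : X.left, x' ⤳ x → Order.coheight x' ≤ 1 →
      t ∈ regularTensors k (localRing X x') p q) :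
    t ∈ regularTensors k (localRing X x) p q := by
  obtain ⟨n, b, β, hβ⟩ := exists_isCoordinateSystem x
  refine hβ.mem_regularTensors_of_forall t
    (fun x' : {x' : X.left // x' ⤳ x ∧ Order.coheight x' ≤ 1} => localRing X x'.1)
    (fun x' => hβ.of_specializes x'.2.1) (fun x' => ht _ x'.2.1 x'.2.2) fun f hf => ?_
  exact mem_localRing_of_coheight_le_one x fun x' h1 h2 => hf ⟨x', h1, h2⟩

end Extension

/-- Without strata of codimension one, points of codimension at most one specialize to points of
dense strata. -/
theorem exists_specializes_mem_stratum {k : Type u} [Field k] [IsAlgClosed k] [CharZero k]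
    {G : Type v} [Group G] [Finite G] {X : Over (Spec (CommRingCat.of k))} [IsVariety X]
    (ρ : G →* Aut X) (hX : ∀ S : Set X.left, IsStratum ρ S → codim S ≠ 1) (x : X.left)
    (hx : Order.coheight x ≤ 1) :
    ∃ x' S, IsStratum ρ S ∧ codim S = 0 ∧ x' ∈ S ∧ x ⤳ x' := by
  obtain ⟨U, hU, -, x, rfl⟩ := exists_isAffineOpen x ⊤ trivial
  obtain ⟨T, hT, hTS, hUT⟩ := exists_finite_strata ρ hU
  have : JacobsonSpace X.left := LocallyOfFiniteType.jacobsonSpace X.hom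
  -- Closed points are dense in locally closed subsets of a Jacobson space. As finitely many strata
  -- contain those in `U`, one stratum suffices to have `x` in the closure.
  have h1 : (x : X.left) ∈
      closure ((closure {(x : X.left)} ∩ (U : Set X.left)) ∩ closedPoints X.left) := by
    rw [JacobsonSpace.closure_inter_closedPoints_eq_closure
      (isClosed_closure.isLocallyClosed.inter U.isOpen.isLocallyClosed)]
    exact subset_closure ⟨subset_closure rfl, x.2⟩
  have h2 : (x : X.left) ∈ closure (⋃ S ∈ T, closure {(x : X.left)} ∩ S) := by
    refine closure_mono ?_ h1
    rintro z ⟨⟨hzx, hzU⟩, hz⟩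
    obtain ⟨S, hS, hzS⟩ := hUT ⟨hzU, hz⟩
    exact Set.mem_biUnion hS ⟨hzx, hzS⟩
  rw [hT.closure_biUnion] at h2
  obtain ⟨S, hS, hxS⟩ := Set.mem_iUnion₂.mp h2
  obtain ⟨x', hx', hx'S⟩ := closure_nonempty_iff.mp ⟨_, hxS⟩
  have h3 : codim S ≤ 1 :=
    (codim_le_coheight (closure_mono Set.inter_subset_right hxS)).trans hx
  have h4 : codim S = 0 :=
     Order.lt_one_iff.mp (lt_of_le_of_ne h3 (hX S (hTS S hS)))
  exact ⟨x', S, hTS S hS, h4, hx'S, specializes_iff_mem_closure.mpr hx'⟩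

end TensorFields

/-! ### The main theorem. -/

theorem corollary3p5p1 {k : Type u} [Field k] [IsAlgClosed k] [CharZero k]
    {G : Type v} [Group G] [Finite G]
    {X Y : Over (Spec (CommRingCat.of k))} [TensorFields.IsVariety X] [TensorFields.IsVariety Y]
    [Smooth X.hom] (ρ : G →* Aut X) (π : X ⟶ Y)
    (hπ : TensorFields.IsGeometricQuotient ρ π)
    (hX : ∀ S : Set X.left, TensorFields.IsStratum ρ S → TensorFields.codim S ≠ 1)
    (p q : ℕ) (τ : TensorFields.RationalTensorField Y p q) :
    TensorFields.RegularOn (TensorFields.pullback hπ.isGenericallyFinite τ) Set.univ ↔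
      TensorFields.RegularOn τ (TensorFields.principalStratum ρ π) := by
  have core {S : Set X.left} (hS : TensorFields.IsStratum ρ S) (hd : genericPoint X.left ∈ closure S)
      {x : X.left} (hx : x ∈ S) := hπ.mem_smoothLocus_and_regularTensors_iff
    (by obtain ⟨_, _, rfl⟩ := hS; exact hx.1) (hS.isFreeAt hd hx)
  constructor
  · rintro h _ ⟨_, ⟨⟨S, hS, rfl⟩, hcodim⟩, x, hx, rfl⟩
    have hd := hπ.genericPoint_mem_closure.mp (TensorFields.codim_eq_zero_iff.mp hcodim)
    obtain ⟨h1, h2⟩ := core hS hd hx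
    exact ⟨h1, (h2 p q τ).mp (h (Set.mem_univ x)).2⟩
  -- Reduction to `x'` of codimension at most one, then to a point `x₀` of a dense stratum in the
  -- closure of `x'`, where regularity on the principal stratum applies.
  · refine fun h x _ => ⟨TensorFields.smoothLocus_eq_univ X ▸ Set.mem_univ x,
      TensorFields.mem_regularTensors_of_coheight_le_one x fun x' _ hx' => ?_⟩
    obtain ⟨x₀, S, hS, hcodim, hx₀, hspec⟩ :=
      TensorFields.exists_specializes_mem_stratum ρ hX x' hx'
    have hd := TensorFields.codim_eq_zero_iff.mp hcodim
    refine TensorFields.mem_regularTensors_of_specializes hspec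
      (((core hS hd hx₀).2 p q τ).mpr (h ?_).2)
    exact ⟨_, ⟨⟨S, hS, rfl⟩,
      TensorFields.codim_eq_zero_iff.mpr (hπ.genericPoint_mem_closure.mpr hd)⟩, x₀, hx₀, rfl⟩
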